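/- Let $d\ge 3$, $\alpha=(d-2)/2$, $l\in\{0,1,2,\dots\}$, and let $\sigma$ be the Euclidean surface measure on the unit sphere $S^{d-1}\subset\mathbb R^d$, normalized so that $\sigma(S^{d-1})=1$. Write $(x\,|\,y)$ for the Euclidean inner product, $r=|x|$ for the norm, $\Delta=\sum_{j=1}^d\partial^2/\partial x_j^2$, let $\mathcal P^l$ be the space of homogeneous polynomials of degree $l$ on $\mathbb R^d$ with complex coefficients, and $\mathcal H^l=\{P\in\mathcal P^l:\Delta P=0\}$. For real $\nu>-1$ and $t\ge0$ let $$j_\nu(t)=\Gamma(\nu+1)\sum_{k=0}^\infty\frac{(-1)^k}{k!\,\Gamma(k+\nu+1)}\Bigl(\frac t2\Bigr)^{2k},$$ so that $j_\nu(t)=\Gamma(\nu+1)(t/2)^{-\nu}J_\nu(t)$ for $t>0$, where $J_\nu$ is the Bessel function of the first kind, and $j_\nu(0)=1$. Let $P\in\mathcal P^l$. For $0\le k\le\lfloor l/2\rfloor$ put $$h_{l-2k}(P)=\sum_{j=0}^{\lfloor l/2\rfloor-k}(-1)^j\frac{(\alpha+l-2k)\,\Gamma(\alpha+l-2k-j)}{4^{k+j}\,k!\,j!\,\Gamma(\alpha+l+1-k)}\,r^{2j}\Delta^{k+j}P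 .$$ These are the harmonic components of $P$: one has $h_{l-2k}(P)\in\mathcal H^{l-2k}$ and $P=\sum_{k=0}^{\lfloor l/2\rfloor}r^{2k}h_{l-2k}(P)$, and they are the only polynomials with these two properties. Moreover, for every $x\in\mathbb R^d$, the Fourier transform of the measure $P\,d\sigma$ on the sphere is given by both of the formulas $$\int_{S^{d-1}}e^{i(x|\eta)}P(\eta)\,d\sigma(\eta)=\Bigl(\frac i2\Bigr)^l\sum_{k=0}^{\lfloor l/2\rfloor}\frac{(-1)^k2^{2k}\,\Gamma(\alpha+1)}{\Gamma(\alpha+l+1-2k)}\,j_{\alpha+l-2k}(|x|)\,h_{l-2k}(P)(x),$$ $$\int_{S^{d-1}}e^{i(x|\eta)}P(\eta)\,d\sigma(\eta)=\Bigl(\frac i2\Bigr)^l\sum_{k=0}^{\lfloor l/2\rfloor}\frac{(-1)^k\,\Gamma(\alpha+1)}{k!\,\Gamma(\alpha+l+1-k)}\,j_{\alpha+l-k}(|x|)\,(\Delta^kP)(x).$$ -/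

import Mathlib

noncomputable section

namespace SphereFourier

open MeasureTheory

/-- The index `α = (d - 2) / 2`. -/
def alpha (d : ℕ) : ℝ := ((d : ℝ) - 2) / 2

/-- The Bessel function of the first kind of real order `ν`, at real arguments `t > 0`. -/
def besselJ (ν t : ℝ) : ℝ :=
  (t / 2) ^ ν *
    ∑' k : ℕ, (-1) ^ k / (Real.Gamma (k + 1) * Real.Gamma (k + ν + 1)) * (t / 2) ^ (2 * k)

/-- The normalized ("spherical") Bessel function `j_ν(t) = Γ(ν + 1) (t / 2)^(-ν) J_ν(t)`, given by
its everywhere convergent power series, so that it also has the right value `1` at `t = 0`;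
see `sphBessel_eq_besselJ` and `sphBessel_zero`. -/
def sphBessel (ν t : ℝ) : ℝ :=
  Real.Gamma (ν + 1) *
    ∑' k : ℕ, (-1) ^ k / (Real.Gamma (k + 1) * Real.Gamma (k + ν + 1)) * (t / 2) ^ (2 * k)

theorem sphBessel_eq_besselJ (ν : ℝ) {t : ℝ} (ht : 0 < t) :
    sphBessel ν t = Real.Gamma (ν + 1) * (t / 2) ^ (-ν) * besselJ ν t := by
  have h : (t / 2) ^ (-ν) * (t / 2) ^ ν = 1 := by
    rw [← Real.rpow_add (by positivity)]; simp
  unfold sphBessel besselJ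
  rw [mul_assoc, ← mul_assoc ((t / 2) ^ (-ν)), h, one_mul]

theorem sphBessel_zero {ν : ℝ} (hν : -1 < ν) : sphBessel ν 0 = 1 := by
  unfold sphBessel
  rw [tsum_eq_single 0]
  · have h : Real.Gamma (ν + 1) ≠ 0 := (Real.Gamma_pos_of_pos (by linarith)).ne'
    simp [h]
  · intro k hk
    simp [hk]

/-- The Laplacian `∑ᵢ ∂²/∂xᵢ²` on polynomials in `d` variables with complex coefficients. -/
def laplacian (d : ℕ) : MvPolynomial (Fin d) ℂ →ₗ[ℂ] MvPolynomial (Fin d) ℂ :=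
  ∑ i : Fin d, (MvPolynomial.pderiv i).toLinearMap ∘ₗ (MvPolynomial.pderiv i).toLinearMap

/-- The polynomial `r² = ∑ᵢ xᵢ²`. -/
def rSq (d : ℕ) : MvPolynomial (Fin d) ℂ := ∑ i : Fin d, MvPolynomial.X i ^ 2

/-- The value of a polynomial at a point of `ℝᵈ`. -/
def evalAt {d : ℕ} (P : MvPolynomial (Fin d) ℂ) (x : EuclideanSpace ℝ (Fin d)) : ℂ :=
  MvPolynomial.eval (fun i => (x i : ℂ)) P

/-- The space of harmonic homogeneous polynomials of degree `m`. -/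
def harmonicSubmodule (d m : ℕ) : Submodule ℂ (MvPolynomial (Fin d) ℂ) :=
  MvPolynomial.homogeneousSubmodule (Fin d) ℂ m ⊓ LinearMap.ker (laplacian d)

/-- `P = ∑_{k ≤ l/2} r^{2k} h_k` with `h_k` harmonic and homogeneous of degree `l - 2k`. -/
def IsHarmonicDecomposition {d : ℕ} (l : ℕ) (P : MvPolynomial (Fin d) ℂ)
    (h : ℕ → MvPolynomial (Fin d) ℂ) : Prop :=
  (∀ k ≤ l / 2, h k ∈ harmonicSubmodule d (l - 2 * k)) ∧
    P = ∑ k ∈ Finset.range (l / 2 + 1), rSq d ^ k * h k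

/-- The coefficient `e^l_j(k)` of the harmonic components. -/
def harmonicCoeff (d l j k : ℕ) : ℝ :=
  (-1) ^ j * ((alpha d + l - 2 * k) * Real.Gamma (alpha d + l - 2 * k - j)) /
    (4 ^ (k + j) * k.factorial * j.factorial * Real.Gamma (alpha d + l + 1 - k))

/-- The harmonic component `h_{l-2k}(P) = ∑_j e^l_j(k) r^{2j} Δ^{k+j} P` of a homogeneous
polynomial `P` of degree `l`. -/
def harmonicComponent {d : ℕ} (l k : ℕ) (P : MvPolynomial (Fin d) ℂ) :
    MvPolynomial (Fin d) ℂ :=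
  ∑ j ∈ Finset.range (l / 2 - k + 1),
    (harmonicCoeff d l j k : ℂ) • (rSq d ^ j * (laplacian d ^ (k + j)) P)

/-- The Euclidean surface measure on the unit sphere, normalized to have total mass `1`. -/
def sphereMeasure (d : ℕ) : Measure (Metric.sphere (0 : EuclideanSpace ℝ (Fin d)) 1) :=
  ((volume : Measure (EuclideanSpace ℝ (Fin d))).toSphere Set.univ)⁻¹ •
    (volume : Measure (EuclideanSpace ℝ (Fin d))).toSphere

/-- The Fourier transform `x ↦ ∫ e^{i(x|η)} P(η) dσ(η)` of the measure `P dσ` on the sphere. -/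
def sphereFourier {d : ℕ} (P : MvPolynomial (Fin d) ℂ) (x : EuclideanSpace ℝ (Fin d)) : ℂ :=
  ∫ η : Metric.sphere (0 : EuclideanSpace ℝ (Fin d)) 1,
    Complex.exp (Complex.I * (inner ℝ x (η : EuclideanSpace ℝ (Fin d)) : ℝ)) *
      evalAt P (η : EuclideanSpace ℝ (Fin d)) ∂(sphereMeasure d)

end SphereFourier

end

noncomputable section

namespace SphereFourier

open MeasureTheory MvPolynomial

variable {d : ℕ}

/-! ### Algebra of the Laplacian -/

/-! Both halves rest on the Laplacian acting on homogeneous polynomials. If `Q` is harmonic of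
degree n, then Δ(r^{2(j+1)} Q) = 4(j+1)(j+1+α+n) r^{2j} Q, with a nonzero factor because α > 0.
Hence Δ sends a decomposition of P to one of ΔP with one term fewer, which gives uniqueness by
induction. For existence, the alternating sum `harmonicComponent l 0 P` is harmonic by telescoping
and differs from P by a multiple of r², so one recurses on the quotient. The formula for the higher
components follows by applying Δ: components and explicit coefficients transform by the same
factors.

For the Fourier transform, expand the exponential and compute the moments ∫ (x|η)^n/n! P(η) dσ. The
tool is ∫ ΔQ dσ = m(m+d-2) ∫ Q dσ for Q homogeneous of degree m (`integral_laplacian_sphere`),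
obtained by integrating by parts against exp(-|x|²) and passing to polar coordinates. Applied to Q =
(x|·)^n/n! · P, it expresses a moment through moments of total degree two less, involving P, its
derivative along x, and ΔP. The closed form `momentFormula` satisfies the same recursion
(`momentFormula_recursion`), so the two agree; moments of odd total degree vanish. Summing over n,
the coefficient of each Δ^k P is a Bessel series, which is the second formula.

For harmonic P only k = 0 survives. Since r = 1 on the sphere, the transform of P is the sum of
those of its harmonic components, and this gives the first formula. -/

theorem laplacian_apply (P : MvPolynomial (Fin d) ℂ) :
    laplacian d P = ∑ i, pderiv i (pderiv i P) := by
  simp [laplacian, LinearMap.sum_apply]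

theorem laplacian_mul (P Q : MvPolynomial (Fin d) ℂ) :
    laplacian d (P * Q) =
      laplacian d P * Q + 2 * ∑ i, pderiv i P * pderiv i Q + P * laplacian d Q := by
  simp only [laplacian_apply, Finset.sum_mul, Finset.mul_sum, ← Finset.sum_add_distrib]
  refine Finset.sum_congr rfl fun i _ => ?_
  simp only [pderiv_mul, map_add]
  ring

theorem isHomogeneous_rSq : (rSq d).IsHomogeneous 2 :=
  IsHomogeneous.sum _ _ _ fun i _ => isHomogeneous_X_pow i 2

theorem isHomogeneous_rSq_pow_mul {Q : MvPolynomial (Fin d) ℂ} {n : ℕ} (hQ : Q.IsHomogeneous n)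
    (j : ℕ) : (rSq d ^ j * Q).IsHomogeneous (2 * j + n) :=
  (isHomogeneous_rSq.pow j).mul hQ

theorem isHomogeneous_laplacian {Q : MvPolynomial (Fin d) ℂ} {n : ℕ} (hQ : Q.IsHomogeneous n) :
    (laplacian d Q).IsHomogeneous (n - 2) := by
  rw [laplacian_apply]
  exact IsHomogeneous.sum _ _ _ fun i _ => hQ.pderiv.pderiv

theorem isHomogeneous_laplacian_pow {Q : MvPolynomial (Fin d) ℂ} {n : ℕ}
    (hQ : Q.IsHomogeneous n) (k : ℕ) : ((laplacian d ^ k) Q).IsHomogeneous (n - 2 * k) := by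
  induction k with
  | zero => simpa using hQ
  | succ k ih =>
    rw [pow_succ', Module.End.mul_apply]
    convert isHomogeneous_laplacian ih using 1
    omega

theorem pderiv_eq_zero_of_isHomogeneous_zero {Q : MvPolynomial (Fin d) ℂ}
    (hQ : Q.IsHomogeneous 0) (i : Fin d) : pderiv i Q = 0 := by
  rw [totalDegree_eq_zero_iff_eq_C.mp ((totalDegree_zero_iff_isHomogeneous _).mpr hQ), pderiv_C]

theorem laplacian_eq_zero_of_isHomogeneous {Q : MvPolynomial (Fin d) ℂ} {n : ℕ}
    (hQ : Q.IsHomogeneous n) (hn : n < 2) : laplacian d Q = 0 := by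
  rw [laplacian_apply]
  refine Finset.sum_eq_zero fun i _ => pderiv_eq_zero_of_isHomogeneous_zero ?_ i
  have := hQ.pderiv (i := i)
  rwa [show n - 1 = 0 by omega] at this

theorem laplacian_pow_eq_zero_of_isHomogeneous {Q : MvPolynomial (Fin d) ℂ} {n k : ℕ}
    (hQ : Q.IsHomogeneous n) (hn : n < 2 * k) : (laplacian d ^ k) Q = 0 := by
  obtain ⟨k, rfl⟩ : ∃ j, k = j + 1 := ⟨k - 1, by omega⟩
  rw [pow_succ', Module.End.mul_apply]
  exact laplacian_eq_zero_of_isHomogeneous (isHomogeneous_laplacian_pow hQ k) (by omega)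

theorem pderiv_rSq (i : Fin d) : pderiv i (rSq d) = 2 * X i := by
  rw [rSq, map_sum, Finset.sum_eq_single i]
  · simp
  · intro j _ hj
    simp [pderiv_X_of_ne hj]
  · simp

theorem laplacian_rSq : laplacian d (rSq d) = C (2 * d : ℂ) := by
  have h (i : Fin d) : pderiv i ((2 : MvPolynomial (Fin d) ℂ) * X i) = C 2 := by
    rw [show (2 : MvPolynomial (Fin d) ℂ) = C 2 from (map_ofNat C 2).symm, pderiv_C_mul,
      pderiv_X_self, mul_one]
  simp only [laplacian_apply, pderiv_rSq, h]
  simp [mul_comm]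

/-- The gradient of r² is 2x, so the cross term in the product rule is a multiple of Euler's
operator and contributes 4n. -/
theorem laplacian_rSq_mul {Q : MvPolynomial (Fin d) ℂ} {n : ℕ} (hQ : Q.IsHomogeneous n) :
    laplacian d (rSq d * Q) = C (2 * d + 4 * n : ℂ) * Q + rSq d * laplacian d Q := by
  have h := hQ.sum_X_mul_pderiv
  rw [laplacian_mul, laplacian_rSq]
  simp only [pderiv_rSq, mul_assoc, ← Finset.mul_sum, h]
  simp only [nsmul_eq_mul, map_add, map_mul, map_natCast, map_ofNat]
  ring

theorem laplacian_rSq_pow_succ_mul {Q : MvPolynomial (Fin d) ℂ} {n : ℕ} (hQ : Q.IsHomogeneous n)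
    (j : ℕ) : laplacian d (rSq d ^ (j + 1) * Q) =
      C (4 * (j + 1) * (j + 1 + (alpha d : ℝ) + n) : ℂ) * (rSq d ^ j * Q) +
        rSq d ^ (j + 1) * laplacian d Q := by
  induction j with
  | zero =>
    simp only [zero_add, pow_one, pow_zero, one_mul, laplacian_rSq_mul hQ, alpha]
    congr 3
    push_cast
    ring
  | succ j ih =>
    rw [pow_succ' _ (j + 1), mul_assoc, laplacian_rSq_mul (isHomogeneous_rSq_pow_mul hQ (j + 1)), ih]
    simp only [alpha]
    push_cast
    simp only [mul_add, ← mul_assoc, mul_comm (rSq d) (C _)]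
    rw [← add_assoc]
    simp only [mul_assoc (C _), ← pow_succ', ← add_mul, ← C_add]
    congr 3
    ring

/-! ### The harmonic decomposition -/

theorem alpha_pos (hd : 3 ≤ d) : 0 < alpha d := by
  have : (3 : ℝ) ≤ d := by exact_mod_cast hd
  unfold alpha
  linarith

theorem mem_harmonicSubmodule {n : ℕ} {Q : MvPolynomial (Fin d) ℂ} :
    Q ∈ harmonicSubmodule d n ↔ Q.IsHomogeneous n ∧ laplacian d Q = 0 := by
  simp [harmonicSubmodule, mem_homogeneousSubmodule]

theorem laplacian_rSq_pow_succ_mul_of_harmonic {n : ℕ} {Q : MvPolynomial (Fin d) ℂ}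
    (hQ : Q ∈ harmonicSubmodule d n) (j : ℕ) :
    laplacian d (rSq d ^ (j + 1) * Q) =
      rSq d ^ j * ((4 * (j + 1) * (j + 1 + (alpha d : ℝ) + n) : ℂ) • Q) := by
  obtain ⟨h, h0⟩ := mem_harmonicSubmodule.mp hQ
  rw [laplacian_rSq_pow_succ_mul h, h0, mul_zero, add_zero, smul_eq_C_mul]
  ring

/-- The harmonic term k = 0 is killed and every other term loses one factor r², so inductions on the
number of terms become possible. -/
theorem laplacian_sum_rSq_pow_mul (K : ℕ) (n : ℕ → ℕ) (h : ℕ → MvPolynomial (Fin d) ℂ)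
    (hh : ∀ k < K + 1, h k ∈ harmonicSubmodule d (n k)) :
    laplacian d (∑ k ∈ Finset.range (K + 1), rSq d ^ k * h k) =
      ∑ k ∈ Finset.range K, rSq d ^ k *
        ((4 * (k + 1) * (k + 1 + (alpha d : ℝ) + n (k + 1)) : ℂ) • h (k + 1)) := by
  rw [Finset.sum_range_succ', map_add, map_sum, pow_zero, one_mul,
    (mem_harmonicSubmodule.mp (hh 0 (by omega))).2, add_zero]
  refine Finset.sum_congr rfl fun k hk => ?_
  exact laplacian_rSq_pow_succ_mul_of_harmonic (hh (k + 1) (by simpa using hk)) k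

theorem laplacian_eigenfactor_ne_zero (hα : 0 < alpha d) (k n : ℕ) :
    (4 * (k + 1) * (k + 1 + (alpha d : ℝ) + n) : ℂ) ≠ 0 := by
  have : (4 * (k + 1) * (k + 1 + alpha d + n) : ℝ) ≠ 0 := by positivity
  exact_mod_cast this

theorem eq_zero_of_sum_rSq_pow_mul_eq_zero (hα : 0 < alpha d) (K : ℕ) (n : ℕ → ℕ)
    (h : ℕ → MvPolynomial (Fin d) ℂ) (hh : ∀ k < K, h k ∈ harmonicSubmodule d (n k))
    (h0 : ∑ k ∈ Finset.range K, rSq d ^ k * h k = 0) : ∀ k < K, h k = 0 := by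
  induction K generalizing n h with
  | zero => intro k hk; omega
  | succ K ih =>
    have h1 := laplacian_sum_rSq_pow_mul K n h hh
    rw [h0, map_zero] at h1
    have h2 := ih (fun k => n (k + 1)) _
      (fun k hk => Submodule.smul_mem _ _ (hh (k + 1) (by omega))) h1.symm
    have h3 : ∀ k < K, h (k + 1) = 0 := fun k hk =>
      (smul_eq_zero.mp (h2 k hk)).resolve_left (laplacian_eigenfactor_ne_zero hα _ _)
    rw [Finset.sum_range_succ', Finset.sum_eq_zero, zero_add, pow_zero, one_mul] at h0
    · rintro (_ | k) hk
      · exact h0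
      · exact h3 k (by omega)
    · intro k hk
      rw [h3 k (by simpa using hk), mul_zero]

theorem IsHarmonicDecomposition.unique (hα : 0 < alpha d) {l : ℕ} {P : MvPolynomial (Fin d) ℂ}
    {h h' : ℕ → MvPolynomial (Fin d) ℂ} (H : IsHarmonicDecomposition l P h)
    (H' : IsHarmonicDecomposition l P h') {k : ℕ} (hk : k ≤ l / 2) : h k = h' k := by
  refine sub_eq_zero.mp (eq_zero_of_sum_rSq_pow_mul_eq_zero hα (l / 2 + 1) (fun k => l - 2 * k)
    (fun k => h k - h' k) (fun k hk => ?_) ?_ k (by omega))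
  · exact Submodule.sub_mem _ (H.1 k (by omega)) (H'.1 k (by omega))
  · simp only [mul_sub, Finset.sum_sub_distrib, ← H.2, ← H'.2, sub_self]

theorem harmonicCoeff_zero_zero (hα : 0 < alpha d) (l : ℕ) : harmonicCoeff d l 0 0 = 1 := by
  have h : alpha d + l ≠ 0 := by positivity
  have hΓ : Real.Gamma (alpha d + l) ≠ 0 := (Real.Gamma_pos_of_pos (by positivity)).ne'
  simp only [harmonicCoeff]
  simp only [Nat.cast_zero, mul_zero, sub_zero, Real.Gamma_add_one h]
  simp [h, hΓ]

/-- This two-term recurrence is exactly the cancellation needed for the Laplacian of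
`harmonicComponent l 0 P` to telescope. -/
theorem harmonicCoeff_succ_zero (hα : 0 < alpha d) {l j : ℕ} (hj : j + 1 ≤ l) :
    harmonicCoeff d l (j + 1) 0 * (4 * (j + 1) * (alpha d + l - (j + 1))) =
      -harmonicCoeff d l j 0 := by
  have hl : (j : ℝ) + 1 ≤ l := by exact_mod_cast hj
  have h : alpha d + l - (j + 1) ≠ 0 := by linarith
  have hΓ : Real.Gamma (alpha d + l + 1) ≠ 0 := (Real.Gamma_pos_of_pos (by positivity)).ne'
  have hrec := Real.Gamma_add_one h
  rw [show alpha d + l - (j + 1) + 1 = alpha d + l - j by ring] at hrec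
  have h1 : (j : ℝ) + 1 ≠ 0 := by positivity
  have h2 : (j.factorial : ℝ) ≠ 0 := by positivity
  simp only [harmonicCoeff, Nat.factorial_succ]
  push_cast
  simp only [mul_zero, sub_zero, hrec, zero_add]
  field_simp
  ring

theorem harmonicComponent_zero_mem (hα : 0 < alpha d) {l : ℕ} {P : MvPolynomial (Fin d) ℂ}
    (hP : P.IsHomogeneous l) : harmonicComponent l 0 P ∈ harmonicSubmodule d l := by
  rw [mem_harmonicSubmodule]
  constructor
  · refine IsHomogeneous.sum _ _ _ fun j hj => ?_
    rw [smul_eq_C_mul]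
    have hj : j ≤ l / 2 := by simpa [Nat.lt_succ_iff] using hj
    have := (isHomogeneous_C (Fin d) (harmonicCoeff d l j 0 : ℂ)).mul
      (isHomogeneous_rSq_pow_mul (isHomogeneous_laplacian_pow hP (0 + j)) j)
    convert this using 1
    omega
  -- Telescoping: the Laplacian of a partial sum is a single boundary term. At N = l/2 that term
  -- contains a power of Δ exceeding half the degree of P, hence vanishes.
  · have key : ∀ N ≤ l / 2, laplacian d (∑ j ∈ Finset.range (N + 1),
        (harmonicCoeff d l j 0 : ℂ) • (rSq d ^ j * (laplacian d ^ j) P)) =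
        (harmonicCoeff d l N 0 : ℂ) • (rSq d ^ N * (laplacian d ^ (N + 1)) P) := by
      intro N hN
      induction N with
      | zero => simp
      | succ N ih =>
        have hc : (harmonicCoeff d l N 0 : ℂ) + (harmonicCoeff d l (N + 1) 0 : ℂ) *
            (4 * (N + 1) * (N + 1 + (alpha d : ℝ) + (l - 2 * (N + 1) : ℕ))) = 0 := by
          have := harmonicCoeff_succ_zero hα (l := l) (j := N) (by omega)
          rw [← sub_eq_zero, sub_neg_eq_add] at this
          rw [Nat.cast_sub (by omega)]
          push_cast
          rw [add_comm, ← Complex.ofReal_zero, ← this]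
          push_cast
          ring
        rw [Finset.sum_range_succ, map_add, ih (by omega), map_smul,
          laplacian_rSq_pow_succ_mul (isHomogeneous_laplacian_pow hP (N + 1)), smul_add, ← add_assoc,
          ← smul_eq_C_mul, smul_smul, ← add_smul, hc, zero_smul, zero_add, pow_succ' _ (N + 1),
          Module.End.mul_apply]
    have := key (l / 2) le_rfl
    rw [laplacian_pow_eq_zero_of_isHomogeneous hP (by omega), mul_zero, smul_zero] at this
    simpa only [harmonicComponent, zero_add, Nat.sub_zero] using this

/-- The term j = 0 of the component is P itself, and all the others carry a factor r². -/
theorem exists_eq_harmonicComponent_zero_add (hα : 0 < alpha d) {l : ℕ}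
    {P : MvPolynomial (Fin d) ℂ} (hP : P.IsHomogeneous (l + 2)) :
    ∃ Q : MvPolynomial (Fin d) ℂ, Q.IsHomogeneous l ∧
      P = harmonicComponent (l + 2) 0 P + rSq d * Q := by
  refine ⟨-∑ j ∈ Finset.range ((l + 2) / 2), (harmonicCoeff d (l + 2) (j + 1) 0 : ℂ) •
    (rSq d ^ j * (laplacian d ^ (j + 1)) P), ?_, ?_⟩
  · refine (IsHomogeneous.sum _ _ _ fun j hj => ?_).neg
    have hj : j < (l + 2) / 2 := by simpa using hj
    rw [smul_eq_C_mul]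
    have := (isHomogeneous_C (Fin d) (harmonicCoeff d (l + 2) (j + 1) 0 : ℂ)).mul
      (isHomogeneous_rSq_pow_mul (isHomogeneous_laplacian_pow hP (j + 1)) j)
    rwa [show 0 + (2 * j + (l + 2 - 2 * (j + 1))) = l by omega] at this
  · rw [harmonicComponent, Nat.sub_zero, Finset.sum_range_succ', harmonicCoeff_zero_zero hα,
      mul_neg, Finset.mul_sum]
    simp only [mul_smul_comm, ← mul_assoc, ← pow_succ', zero_add]
    simp

theorem exists_isHarmonicDecomposition (hα : 0 < alpha d) {l : ℕ} {P : MvPolynomial (Fin d) ℂ}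
    (hP : P.IsHomogeneous l) :
    ∃ h, IsHarmonicDecomposition l P h ∧ h 0 = harmonicComponent l 0 P := by
  induction l using Nat.strong_induction_on generalizing P with
  | _ l ih =>
    by_cases hl : l < 2
    · have hl2 : l / 2 = 0 := by omega
      have h0 : harmonicComponent l 0 P = P := by
        simp [harmonicComponent, hl2, harmonicCoeff_zero_zero hα]
      refine ⟨fun _ => P, ⟨fun k hk => ?_, by simp [hl2]⟩, h0.symm⟩
      obtain rfl : k = 0 := by omega
      simpa using mem_harmonicSubmodule.mpr ⟨hP, laplacian_eq_zero_of_isHomogeneous hP hl⟩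
    · obtain ⟨l, rfl⟩ : ∃ m, l = m + 2 := ⟨l - 2, by omega⟩
      obtain ⟨Q, hQ, hPQ⟩ := exists_eq_harmonicComponent_zero_add hα hP
      obtain ⟨q, hq, -⟩ := ih l (by omega) hQ
      refine ⟨fun k => if k = 0 then harmonicComponent (l + 2) 0 P else q (k - 1), ⟨?_, ?_⟩, rfl⟩
      · rintro (_ | k) hk
        · exact harmonicComponent_zero_mem hα hP
        · have := hq.1 k (by omega)
          rw [show l - 2 * k = l + 2 - 2 * (k + 1) by omega] at this
          simpa using this
      · rw [show (l + 2) / 2 = l / 2 + 1 by omega, Finset.sum_range_succ']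
        simp only [Nat.add_eq_zero_iff, one_ne_zero, and_false, if_false, if_true, pow_zero,
          one_mul, Nat.add_sub_cancel, pow_succ', mul_assoc, ← Finset.mul_sum, ← hq.2]
        rw [add_comm]
        exact hPQ

theorem IsHarmonicDecomposition.laplacian {l : ℕ} {P : MvPolynomial (Fin d) ℂ}
    {h : ℕ → MvPolynomial (Fin d) ℂ} (H : IsHarmonicDecomposition (l + 2) P h) :
    IsHarmonicDecomposition l (laplacian d P)
      (fun k => (4 * (k + 1) * (k + 1 + (alpha d : ℝ) + (l - 2 * k : ℕ)) : ℂ) • h (k + 1)) := by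
  constructor
  · intro k hk
    have := H.1 (k + 1) (by omega)
    rw [show l + 2 - 2 * (k + 1) = l - 2 * k by omega] at this
    exact Submodule.smul_mem _ _ this
  · conv_lhs => rw [H.2]
    rw [laplacian_sum_rSq_pow_mul _ (fun k => l + 2 - 2 * k) _ (fun k hk => H.1 k (by omega)),
      show (l + 2) / 2 = l / 2 + 1 by omega]
    refine Finset.sum_congr rfl fun k hk => ?_
    rw [show l + 2 - 2 * (k + 1) = l - 2 * k by omega]

/-- The last bracket equals α+l+1-k, which is the quotient of the two Gamma factors in the
denominators; 4(k+1) accounts for the power of 4 and the factorial. -/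
theorem harmonicCoeff_succ (hα : 0 < alpha d) {l k : ℕ} (j : ℕ) (hk : k ≤ l / 2) :
    (4 * (k + 1) * (k + 1 + alpha d + (l - 2 * k : ℕ))) * harmonicCoeff d (l + 2) j (k + 1) =
      harmonicCoeff d l j k := by
  have hk2 : 2 * k ≤ l := by omega
  have hl : 2 * (k : ℝ) ≤ l := by exact_mod_cast hk2
  have h : alpha d + l + 1 - k ≠ 0 := by linarith [(Nat.cast_nonneg k : (0 : ℝ) ≤ k)]
  have hΓ : Real.Gamma (alpha d + l + 1 - k) ≠ 0 :=
    (Real.Gamma_pos_of_pos (by linarith [(Nat.cast_nonneg k : (0 : ℝ) ≤ k)])).ne'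
  have h1 : (k : ℝ) + 1 ≠ 0 := by positivity
  have h2 : (k.factorial : ℝ) ≠ 0 := by positivity
  have h3 : (j.factorial : ℝ) ≠ 0 := by positivity
  simp only [harmonicCoeff, Nat.factorial_succ]
  rw [Nat.cast_sub hk2]
  push_cast
  rw [show alpha d + (l + 2) + 1 - (k + 1) = alpha d + l + 1 - k + 1 by ring,
    Real.Gamma_add_one h, show alpha d + (l + 2) - 2 * (k + 1) = alpha d + l - 2 * k by ring,
    show (k + 1 + alpha d + (l - 2 * k)) = alpha d + l + 1 - k by ring]
  rw [show k + 1 + j = (k + j) + 1 by ring, pow_succ]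
  field_simp

theorem smul_harmonicComponent_succ (hα : 0 < alpha d) {l k : ℕ} (hk : k ≤ l / 2)
    (P : MvPolynomial (Fin d) ℂ) :
    (4 * (k + 1) * (k + 1 + (alpha d : ℝ) + (l - 2 * k : ℕ)) : ℂ) •
      harmonicComponent (l + 2) (k + 1) P = harmonicComponent l k (laplacian d P) := by
  simp only [harmonicComponent, Finset.smul_sum, smul_smul]
  rw [show (l + 2) / 2 - (k + 1) = l / 2 - k by omega]
  refine Finset.sum_congr rfl fun j _ => ?_
  rw [← harmonicCoeff_succ hα j hk, show k + 1 + j = k + j + 1 by ring, pow_succ,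
    Module.End.mul_apply]
  push_cast
  rfl

/-- Induction on k, with P varying: component k+1 of P and component k of ΔP differ by a nonzero
factor, and the explicit formula obeys the same relation. -/
theorem IsHarmonicDecomposition.eq_harmonicComponent (hα : 0 < alpha d) {l k : ℕ}
    {P : MvPolynomial (Fin d) ℂ} (hP : P.IsHomogeneous l) {h : ℕ → MvPolynomial (Fin d) ℂ}
    (H : IsHarmonicDecomposition l P h) (hk : k ≤ l / 2) : h k = harmonicComponent l k P := by
  induction k generalizing l P h with
  | zero =>
    obtain ⟨h', H', h0⟩ := exists_isHarmonicDecomposition hα hP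
    rw [← h0, H.unique hα H' (Nat.zero_le _)]
  | succ k ih =>
    obtain ⟨l, rfl⟩ : ∃ m, l = m + 2 := ⟨l - 2, by omega⟩
    have hk' : k ≤ l / 2 := by omega
    have := ih (isHomogeneous_laplacian hP) H.laplacian hk'
    rw [Nat.add_sub_cancel, ← smul_harmonicComponent_succ hα hk'] at this
    exact smul_right_injective _ (laplacian_eigenfactor_ne_zero hα _ _) this

theorem isHarmonicDecomposition_harmonicComponent (hα : 0 < alpha d) {l : ℕ}
    {P : MvPolynomial (Fin d) ℂ} (hP : P.IsHomogeneous l) :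
    IsHarmonicDecomposition l P (fun k => harmonicComponent l k P) := by
  obtain ⟨h, H, -⟩ := exists_isHarmonicDecomposition hα hP
  refine ⟨fun k hk => ?_, ?_⟩
  · have := H.1 k hk
    rwa [H.eq_harmonicComponent hα hP hk] at this
  · conv_lhs => rw [H.2]
    refine Finset.sum_congr rfl fun k hk => ?_
    rw [H.eq_harmonicComponent hα hP (by simpa [Nat.lt_succ_iff] using hk)]

/-! ### Polynomials as functions -/

theorem evalAt_add (P Q : MvPolynomial (Fin d) ℂ) (x : EuclideanSpace ℝ (Fin d)) :
    evalAt (P + Q) x = evalAt P x + evalAt Q x := map_add _ _ _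

theorem evalAt_mul (P Q : MvPolynomial (Fin d) ℂ) (x : EuclideanSpace ℝ (Fin d)) :
    evalAt (P * Q) x = evalAt P x * evalAt Q x := map_mul _ _ _

theorem evalAt_pow (P : MvPolynomial (Fin d) ℂ) (n : ℕ) (x : EuclideanSpace ℝ (Fin d)) :
    evalAt (P ^ n) x = evalAt P x ^ n := map_pow _ _ _

theorem evalAt_sum {ι : Type*} (s : Finset ι) (P : ι → MvPolynomial (Fin d) ℂ)
    (x : EuclideanSpace ℝ (Fin d)) : evalAt (∑ i ∈ s, P i) x = ∑ i ∈ s, evalAt (P i) x :=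
  map_sum _ _ _

theorem evalAt_C (c : ℂ) (x : EuclideanSpace ℝ (Fin d)) : evalAt (C c) x = c := eval_C c

theorem evalAt_X (i : Fin d) (x : EuclideanSpace ℝ (Fin d)) : evalAt (X i) x = x i := eval_X i

theorem evalAt_zero (x : EuclideanSpace ℝ (Fin d)) :
    evalAt (0 : MvPolynomial (Fin d) ℂ) x = 0 := map_zero _

theorem evalAt_rSq (x : EuclideanSpace ℝ (Fin d)) : evalAt (rSq d) x = ((‖x‖ ^ 2 : ℝ) : ℂ) := by
  rw [EuclideanSpace.real_norm_sq_eq, rSq, evalAt_sum]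
  simp [evalAt_pow, evalAt_X]

theorem evalAt_smul_of_isHomogeneous {P : MvPolynomial (Fin d) ℂ} {m : ℕ}
    (hP : P.IsHomogeneous m) (t : ℝ) (x : EuclideanSpace ℝ (Fin d)) :
    evalAt P (t • x) = (t : ℂ) ^ m * evalAt P x := by
  simp only [evalAt, eval_eq, Finset.mul_sum]
  refine Finset.sum_congr rfl fun s hs => ?_
  have hs' : ∑ i, s i = m := by
    rw [← hP (mem_support_iff.mp hs), Finsupp.weight_apply, Finsupp.sum_fintype] <;> simp
  simp only [PiLp.smul_apply, smul_eq_mul, Complex.ofReal_mul, mul_pow, Finset.prod_mul_distrib,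
    Finset.prod_pow_eq_pow_sum]
  have h2 : ∑ i ∈ s.support, s i = m := by
    rw [← hs']
    exact Finset.sum_subset (Finset.subset_univ _) fun i _ hi => by simpa using hi
  rw [h2]
  ring

theorem hasFDerivAt_evalAt (P : MvPolynomial (Fin d) ℂ) (x : EuclideanSpace ℝ (Fin d)) :
    HasFDerivAt (𝕜 := ℝ) (evalAt P) (∑ i, (Complex.ofRealCLM.comp
      (EuclideanSpace.proj i : EuclideanSpace ℝ (Fin d) →L[ℝ] ℝ)).smulRight
        (evalAt (pderiv i P) x)) x := by
  induction P using MvPolynomial.induction_on with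
  | C a =>
    have h : (evalAt (C a) : EuclideanSpace ℝ (Fin d) → ℂ) = fun _ => a := by
      ext y
      exact evalAt_C a y
    simp only [h, pderiv_C, evalAt_zero, ContinuousLinearMap.smulRight_zero, Finset.sum_const_zero]
    exact hasFDerivAt_const a x
  | add p q hp hq =>
    rw [show (evalAt (p + q) : EuclideanSpace ℝ (Fin d) → ℂ) =
        fun y => evalAt p y + evalAt q y by
      funext y; exact evalAt_add p q y]
    refine (hp.add hq).congr_fderiv ?_
    ext v
    simp [evalAt_add, mul_add, Finset.sum_add_distrib]
  | mul_X p j hp =>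
    have hX : HasFDerivAt (𝕜 := ℝ) (evalAt (X j)) (Complex.ofRealCLM.comp
        (EuclideanSpace.proj j : EuclideanSpace ℝ (Fin d) →L[ℝ] ℝ)) x := by
      convert (Complex.ofRealCLM.comp
        (EuclideanSpace.proj j : EuclideanSpace ℝ (Fin d) →L[ℝ] ℝ)).hasFDerivAt using 1
      ext y
      simp [evalAt_X]
    rw [show (evalAt (p * X j) : EuclideanSpace ℝ (Fin d) → ℂ) =
        fun y => evalAt p y * evalAt (X j) y by
      funext y; exact evalAt_mul p (X j) y]
    refine (hp.mul hX).congr_fderiv ?_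
    ext v
    simp only [sum_apply, ContinuousLinearMap.smulRight_apply,
      ContinuousLinearMap.comp_apply, add_apply, smul_apply, pderiv_mul, evalAt_add, evalAt_mul,
      smul_eq_mul, mul_add, Finset.sum_add_distrib, Finset.mul_sum, pderiv_X]
    rw [add_comm]
    congr 1
    · exact Finset.sum_congr rfl fun i _ => by ring
    · rw [Finset.sum_eq_single j]
      · simp [evalAt, mul_comm]
      · intro i _ hi
        simp [hi.symm, evalAt_zero]
      · simp

theorem fderiv_evalAt (P : MvPolynomial (Fin d) ℂ) (x : EuclideanSpace ℝ (Fin d)) (i : Fin d) :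
    fderiv ℝ (evalAt P) x (EuclideanSpace.single i 1) = evalAt (pderiv i P) x := by
  rw [(hasFDerivAt_evalAt P x).fderiv, sum_apply, Finset.sum_eq_single i]
  · simp
  · intro j _ hj
    simp [hj]
  · simp

theorem continuous_evalAt (P : MvPolynomial (Fin d) ℂ) :
    Continuous (evalAt P : EuclideanSpace ℝ (Fin d) → ℂ) :=
  continuous_iff_continuousAt.mpr fun x => (hasFDerivAt_evalAt P x).continuousAt

/-! ### Integration over the sphere -/

theorem integrable_sphere_of_continuous {E : Type*} [NormedAddCommGroup E]
    {μ : Measure (Metric.sphere (0 : EuclideanSpace ℝ (Fin d)) 1)} [IsFiniteMeasure μ]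
    {f : Metric.sphere (0 : EuclideanSpace ℝ (Fin d)) 1 → E} (hf : Continuous f) :
    Integrable f μ :=
  hf.integrable_of_hasCompactSupport (HasCompactSupport.of_compactSpace f)

theorem finrank_euclidean : Module.finrank ℝ (EuclideanSpace ℝ (Fin d)) = d := by simp

theorem integrableOn_pow_mul_exp_neg_sq (n : ℕ) :
    IntegrableOn (fun r : ℝ => r ^ n * Real.exp (-r ^ 2)) (Set.Ioi 0) := by
  have hn : (-1 : ℝ) < n := by linarith [(Nat.cast_nonneg n : (0 : ℝ) ≤ n)]
  refine (integrableOn_rpow_mul_exp_neg_rpow hn two_pos).congr_fun (fun r _ => ?_)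
    measurableSet_Ioi
  simp

theorem integral_pow_mul_exp_neg_sq (n : ℕ) :
    ∫ r in Set.Ioi (0 : ℝ), r ^ n * Real.exp (-r ^ 2) = Real.Gamma ((n + 1) / 2) / 2 := by
  have hn : (-1 : ℝ) < n := by linarith [(Nat.cast_nonneg n : (0 : ℝ) ≤ n)]
  rw [show Real.Gamma ((n + 1) / 2) / 2 = 1 / 2 * Real.Gamma ((n + 1) / 2) by ring,
    ← integral_rpow_mul_exp_neg_rpow two_pos hn]
  simp

theorem integrable_volumeIoiPow (m n : ℕ) :
    Integrable (fun r : Set.Ioi (0 : ℝ) => (((r : ℝ) ^ m * Real.exp (-(r : ℝ) ^ 2) : ℝ) : ℂ))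
      (Measure.volumeIoiPow n) := by
  refine Integrable.ofReal ?_
  rw [Measure.volumeIoiPow, integrable_withDensity_iff_integrable_smul' (by fun_prop) (by simp)]
  have h := (integrableOn_iff_comap_subtypeVal measurableSet_Ioi).mp
    (integrableOn_pow_mul_exp_neg_sq (n + m))
  refine h.congr (Filter.Eventually.of_forall fun r => ?_)
  have hr : (0 : ℝ) < r := r.2
  simp only [Function.comp_apply, smul_eq_mul]
  rw [ENNReal.toReal_ofReal (by positivity), pow_add]
  exact mul_assoc _ _ _

theorem integral_volumeIoiPow (m n : ℕ) :
    ∫ r : Set.Ioi (0 : ℝ), (((r : ℝ) ^ m * Real.exp (-(r : ℝ) ^ 2) : ℝ) : ℂ)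
      ∂Measure.volumeIoiPow n = ((Real.Gamma ((n + m + 1) / 2) / 2 : ℝ) : ℂ) := by
  rw [integral_complex_ofReal]
  congr 1
  simp only [Measure.volumeIoiPow, ENNReal.ofReal]
  rw [integral_withDensity_eq_integral_smul (by fun_prop),
    integral_subtype_comap measurableSet_Ioi
      fun r : ℝ => Real.toNNReal (r ^ n) • (r ^ m * Real.exp (-r ^ 2))]
  have := integral_pow_mul_exp_neg_sq (n + m)
  push_cast at this
  rw [← this]
  refine setIntegral_congr_fun measurableSet_Ioi fun r hr => ?_
  simp only [NNReal.smul_def, Real.coe_toNNReal _ (pow_nonneg (le_of_lt hr) n), smul_eq_mul]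
  rw [pow_add, mul_assoc]

/-- In polar coordinates, a homogeneous polynomial times the Gaussian is a product. -/
theorem evalAt_mul_exp_polar {P : MvPolynomial (Fin d) ℂ} {m : ℕ} (hP : P.IsHomogeneous m)
    (x : ({0}ᶜ : Set (EuclideanSpace ℝ (Fin d)))) :
    evalAt P x * (Real.exp (-‖(x : EuclideanSpace ℝ (Fin d))‖ ^ 2) : ℂ) =
      evalAt P (homeomorphUnitSphereProd _ x).1 *
        ((((homeomorphUnitSphereProd _ x).2 : ℝ) ^ m *
          Real.exp (-((homeomorphUnitSphereProd _ x).2 : ℝ) ^ 2) : ℝ) : ℂ) := by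
  have hx : ‖(x : EuclideanSpace ℝ (Fin d))‖ ≠ 0 := norm_ne_zero_iff.mpr x.2
  rw [homeomorphUnitSphereProd_apply_fst_coe, homeomorphUnitSphereProd_apply_snd_coe,
    evalAt_smul_of_isHomogeneous hP]
  have hx' : (‖(x : EuclideanSpace ℝ (Fin d))‖ : ℂ) ≠ 0 := by exact_mod_cast hx
  push_cast
  rw [inv_pow]
  field_simp

theorem integrable_evalAt_mul_exp (hd : 0 < d) {P : MvPolynomial (Fin d) ℂ} {m : ℕ}
    (hP : P.IsHomogeneous m) :
    Integrable (fun x : EuclideanSpace ℝ (Fin d) => evalAt P x * (Real.exp (-‖x‖ ^ 2) : ℂ)) := by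
  have : Nonempty (Fin d) := ⟨⟨0, hd⟩⟩
  have h := (volume : Measure (EuclideanSpace ℝ (Fin d))).measurePreserving_homeomorphUnitSphereProd
  rw [← restrict_compl_singleton (μ := volume) (0 : EuclideanSpace ℝ (Fin d)),
    ← IntegrableOn, integrableOn_iff_comap_subtypeVal (measurableSet_singleton _).compl]
  have h2 := (h.integrable_comp_emb (Homeomorph.measurableEmbedding _)).mpr
    ((integrable_sphere_of_continuous (μ := (volume : Measure (EuclideanSpace ℝ (Fin d))).toSphere)
      ((continuous_evalAt P).comp continuous_subtype_val)).mul_prod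
      (integrable_volumeIoiPow m (Module.finrank ℝ (EuclideanSpace ℝ (Fin d)) - 1)))
  exact h2.congr (Filter.Eventually.of_forall fun x => (evalAt_mul_exp_polar hP x).symm)

/-- By homogeneity the integrand splits in polar coordinates, so Gaussian integrals over space
determine integrals over the sphere. -/
theorem integral_evalAt_mul_exp (hd : 0 < d) {P : MvPolynomial (Fin d) ℂ} {m : ℕ}
    (hP : P.IsHomogeneous m) :
    ∫ x : EuclideanSpace ℝ (Fin d), evalAt P x * (Real.exp (-‖x‖ ^ 2) : ℂ) =
      (∫ η : Metric.sphere (0 : EuclideanSpace ℝ (Fin d)) 1, evalAt P η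
        ∂(volume : Measure (EuclideanSpace ℝ (Fin d))).toSphere) *
        ((Real.Gamma ((d + m) / 2) / 2 : ℝ) : ℂ) := by
  have : Nonempty (Fin d) := ⟨⟨0, hd⟩⟩
  have h := (volume : Measure (EuclideanSpace ℝ (Fin d))).measurePreserving_homeomorphUnitSphereProd
  have h1 := integral_subtype_comap (μ := volume)
    (measurableSet_singleton (0 : EuclideanSpace ℝ (Fin d))).compl
    fun x : EuclideanSpace ℝ (Fin d) => evalAt P x * (Real.exp (-‖x‖ ^ 2) : ℂ)
  rw [restrict_compl_singleton] at h1
  rw [← h1]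
  simp_rw [evalAt_mul_exp_polar hP]
  rw [h.integral_comp (Homeomorph.measurableEmbedding _) (fun z => evalAt P z.1 *
    (((z.2 : ℝ) ^ m * Real.exp (-(z.2 : ℝ) ^ 2) : ℝ) : ℂ)),
    integral_prod_mul (fun η : Metric.sphere (0 : EuclideanSpace ℝ (Fin d)) 1 =>
      evalAt P (η : EuclideanSpace ℝ (Fin d)))
      fun r : Set.Ioi (0 : ℝ) => (((r : ℝ) ^ m * Real.exp (-(r : ℝ) ^ 2) : ℝ) : ℂ),
    integral_volumeIoiPow, finrank_euclidean, Nat.cast_sub hd]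
  congr 5
  push_cast
  ring

theorem integral_pderiv_mul_exp (hd : 0 < d) {P : MvPolynomial (Fin d) ℂ} {m : ℕ}
    (hP : P.IsHomogeneous m) (i : Fin d) :
    ∫ x : EuclideanSpace ℝ (Fin d), evalAt (pderiv i P) x * (Real.exp (-‖x‖ ^ 2) : ℂ) =
      2 * ∫ x : EuclideanSpace ℝ (Fin d), evalAt (X i * P) x * (Real.exp (-‖x‖ ^ 2) : ℂ) := by
  have hg (x : EuclideanSpace ℝ (Fin d)) : HasFDerivAt
      (fun x : EuclideanSpace ℝ (Fin d) => (Real.exp (-‖x‖ ^ 2) : ℂ))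
      (Complex.ofRealCLM.comp (Real.exp (-‖x‖ ^ 2) • -(2 • innerSL ℝ x))) x :=
    Complex.ofRealCLM.hasFDerivAt.comp x ((hasStrictFDerivAt_norm_sq x).hasFDerivAt.neg.exp)
  have hg' (x : EuclideanSpace ℝ (Fin d)) : fderiv ℝ
      (fun x : EuclideanSpace ℝ (Fin d) => (Real.exp (-‖x‖ ^ 2) : ℂ)) x
      (EuclideanSpace.single i 1) = -2 * (x i * (Real.exp (-‖x‖ ^ 2) : ℂ)) := by
    rw [(hg x).fderiv]
    simp [EuclideanSpace.inner_single_right]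
    ring
  have h1 : Integrable (fun x : EuclideanSpace ℝ (Fin d) => evalAt P x * fderiv ℝ
      (fun x : EuclideanSpace ℝ (Fin d) => (Real.exp (-‖x‖ ^ 2) : ℂ)) x
      (EuclideanSpace.single i 1)) := by
    refine ((integrable_evalAt_mul_exp hd ((isHomogeneous_X ℂ i).mul hP)).const_mul (-2)).congr
      (Filter.Eventually.of_forall fun x => ?_)
    simp only [hg', evalAt_mul, evalAt_X]
    ring
  have h2 : Integrable (fun x : EuclideanSpace ℝ (Fin d) => fderiv ℝ (evalAt P) x
      (EuclideanSpace.single i 1) * (Real.exp (-‖x‖ ^ 2) : ℂ)) := by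
    simp_rw [fderiv_evalAt]
    exact integrable_evalAt_mul_exp hd hP.pderiv
  have key := integral_mul_fderiv_eq_neg_fderiv_mul_of_integrable h2 h1
    (integrable_evalAt_mul_exp hd hP)
    (fun x _ => (hasFDerivAt_evalAt P x).differentiableAt)
    (fun x _ => (hg x).differentiableAt)
  simp_rw [fderiv_evalAt, hg'] at key
  rw [eq_neg_iff_add_eq_zero, add_comm, ← eq_neg_iff_add_eq_zero] at key
  rw [key, ← integral_neg, ← integral_const_mul]
  refine integral_congr_ae (Filter.Eventually.of_forall fun x => ?_)
  simp only [evalAt_mul, evalAt_X]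
  ring

theorem integral_laplacian_mul_exp (hd : 0 < d) {P : MvPolynomial (Fin d) ℂ} {m : ℕ}
    (hP : P.IsHomogeneous m) :
    ∫ x : EuclideanSpace ℝ (Fin d), evalAt (laplacian d P) x * (Real.exp (-‖x‖ ^ 2) : ℂ) =
      2 * m * ∫ x : EuclideanSpace ℝ (Fin d), evalAt P x * (Real.exp (-‖x‖ ^ 2) : ℂ) := by
  rw [laplacian_apply]
  simp_rw [evalAt_sum, Finset.sum_mul]
  rw [integral_finsetSum _ fun i _ => integrable_evalAt_mul_exp hd hP.pderiv.pderiv]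
  simp_rw [fun i => integral_pderiv_mul_exp hd (hP.pderiv (i := i)) i]
  rw [← Finset.mul_sum, ← integral_finsetSum _ fun i _ =>
    integrable_evalAt_mul_exp hd ((isHomogeneous_X ℂ i).mul hP.pderiv), mul_assoc,
    ← integral_const_mul (m : ℂ)]
  refine congrArg (2 * ·) (integral_congr_ae (Filter.Eventually.of_forall fun x => ?_))
  simp only
  rw [← Finset.sum_mul, ← evalAt_sum, hP.sum_X_mul_pderiv, nsmul_eq_mul, evalAt_mul, mul_assoc]
  congr 1
  simp [evalAt]

theorem integral_sphereMeasure {E : Type*} [NormedAddCommGroup E] [NormedSpace ℝ E]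
    (f : Metric.sphere (0 : EuclideanSpace ℝ (Fin d)) 1 → E) :
    ∫ η, f η ∂sphereMeasure d =
      ((volume : Measure (EuclideanSpace ℝ (Fin d))).toSphere Set.univ)⁻¹.toReal •
        ∫ η, f η ∂(volume : Measure (EuclideanSpace ℝ (Fin d))).toSphere :=
  integral_smul_measure _ _

/-- The Gaussian identity has factor 2m; the radial integrals in degrees m and m-2 have ratio
(d+m-2)/2 by the functional equation of Gamma. -/
theorem integral_laplacian_sphere (hd : 0 < d) {P : MvPolynomial (Fin d) ℂ} {m : ℕ}
    (hP : P.IsHomogeneous m) :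
    ∫ η : Metric.sphere (0 : EuclideanSpace ℝ (Fin d)) 1, evalAt (laplacian d P) η
        ∂sphereMeasure d =
      m * (d + m - 2) * ∫ η : Metric.sphere (0 : EuclideanSpace ℝ (Fin d)) 1, evalAt P η
        ∂sphereMeasure d := by
  simp only [integral_sphereMeasure, mul_smul_comm]
  congr 1
  have h := integral_laplacian_mul_exp hd hP
  rw [integral_evalAt_mul_exp hd hP, integral_evalAt_mul_exp hd (isHomogeneous_laplacian hP)] at h
  have hd' : (0 : ℝ) < d := by exact_mod_cast hd
  rcases lt_or_ge m 2 with hm | hm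
  -- In degree below 2 the truncated degree m-2 carries no information, but ΔP = 0 and the Gaussian
  -- identity says that m = 0 or the integral of P vanishes.
  · rw [laplacian_eq_zero_of_isHomogeneous hP hm] at h ⊢
    have hΓ : Real.Gamma ((d + m) / 2) ≠ 0 := (Real.Gamma_pos_of_pos (by positivity)).ne'
    simp only [evalAt_zero, integral_zero, zero_mul] at h ⊢
    simp only [eq_comm (a := (0 : ℂ)), mul_eq_zero, Complex.ofReal_eq_zero, div_eq_zero_iff,
      hΓ, false_or] at h ⊢
    norm_num at h ⊢
    tauto
  · obtain ⟨m, rfl⟩ : ∃ k, m = k + 2 := ⟨m - 2, by omega⟩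
    have h0 : ((d : ℝ) + m) / 2 ≠ 0 := by positivity
    have hΓ : (Real.Gamma ((d + m) / 2) : ℂ) ≠ 0 := by
      exact_mod_cast (Real.Gamma_pos_of_pos (by positivity)).ne'
    rw [Nat.add_sub_cancel, show (((m + 2 : ℕ) : ℝ)) = m + 2 by push_cast; rfl,
      show ((d : ℝ) + (m + 2)) / 2 = (d + m) / 2 + 1 by ring, Real.Gamma_add_one h0] at h
    push_cast at h ⊢
    refine mul_right_cancel₀ (div_ne_zero hΓ two_ne_zero) (h.trans ?_)
    ring

theorem isProbabilityMeasure_sphereMeasure (hd : 0 < d) :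
    IsProbabilityMeasure (sphereMeasure d) := by
  have : Nonempty (Fin d) := ⟨⟨0, hd⟩⟩
  constructor
  rw [sphereMeasure, Measure.smul_apply, smul_eq_mul]
  refine ENNReal.inv_mul_cancel ?_ (measure_ne_top _ _)
  rw [Measure.measure_univ_ne_zero]
  exact Measure.toSphere_ne_zero _

/-! ### Divided powers with integer exponents -/

/-- The divided power `a ^ z / z!`, which is `0` for negative `z`. -/
def dividedPow {A : Type*} [CommRing A] [Algebra ℂ A] (a : A) (z : ℤ) : A :=
  if z < 0 then 0 else ((z.toNat.factorial : ℂ)⁻¹) • a ^ z.toNat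

section dividedPow

variable {A : Type*} [CommRing A] [Algebra ℂ A] (a : A)

theorem dividedPow_of_neg {z : ℤ} (hz : z < 0) : dividedPow a z = 0 := if_pos hz

theorem dividedPow_natCast (n : ℕ) :
    dividedPow a (n : ℤ) = ((n.factorial : ℂ)⁻¹) • a ^ n := by
  simp [dividedPow]

theorem dividedPow_zero : dividedPow a 0 = 1 := by simp [dividedPow]

/-- At z = 0 both sides vanish. This uniformity in z lets the moment recursion run without boundary
cases. -/
theorem mul_dividedPow_sub_one (z : ℤ) :
    a * dividedPow a (z - 1) = (z : ℂ) • dividedPow a z := by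
  rcases lt_trichotomy z 0 with hz | rfl | hz
  · rw [dividedPow_of_neg a hz, dividedPow_of_neg a (by omega), mul_zero, smul_zero]
  · rw [dividedPow_of_neg a (by omega), mul_zero, Int.cast_zero, zero_smul]
  · obtain ⟨n, rfl⟩ : ∃ n : ℕ, z = (n + 1 : ℕ) := ⟨z.toNat - 1, by omega⟩
    rw [show ((n + 1 : ℕ) : ℤ) - 1 = (n : ℕ) by push_cast; ring, dividedPow_natCast,
      dividedPow_natCast, mul_smul_comm, ← pow_succ', smul_smul]
    congr 1
    have h1 : (n : ℂ) + 1 ≠ 0 := by exact_mod_cast n.succ_ne_zero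
    have h2 : (n.factorial : ℂ) ≠ 0 := by exact_mod_cast n.factorial_ne_zero
    rw [Nat.factorial_succ]
    push_cast
    field_simp

end dividedPow

theorem pderiv_dividedPow (a : MvPolynomial (Fin d) ℂ) (z : ℤ) (i : Fin d) :
    pderiv i (dividedPow a z) = dividedPow a (z - 1) * pderiv i a := by
  rcases lt_trichotomy z 0 with hz | rfl | hz
  · rw [dividedPow_of_neg a hz, dividedPow_of_neg a (by omega), zero_mul, map_zero]
  · rw [dividedPow_of_neg a (z := 0 - 1) (by omega), dividedPow_zero, pderiv_one, zero_mul]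
  · obtain ⟨n, rfl⟩ : ∃ n : ℕ, z = (n + 1 : ℕ) := ⟨z.toNat - 1, by omega⟩
    rw [show ((n + 1 : ℕ) : ℤ) - 1 = (n : ℕ) by push_cast; ring, dividedPow_natCast,
      dividedPow_natCast, Derivation.map_smul, pderiv_pow]
    have h1 : (n : ℂ) + 1 ≠ 0 := by exact_mod_cast n.succ_ne_zero
    have h2 : (n.factorial : ℂ) ≠ 0 := by exact_mod_cast n.factorial_ne_zero
    rw [smul_mul_assoc, Nat.add_sub_cancel, mul_assoc, ← nsmul_eq_mul, ← Nat.cast_smul_eq_nsmul ℂ,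
      smul_smul]
    congr 1
    rw [Nat.factorial_succ]
    push_cast
    field_simp

theorem isHomogeneous_dividedPow {a : MvPolynomial (Fin d) ℂ} (ha : a.IsHomogeneous 1) (n : ℕ) :
    (dividedPow a (n : ℤ)).IsHomogeneous n := by
  rw [dividedPow_natCast, smul_eq_C_mul]
  simpa using (isHomogeneous_C (Fin d) ((n.factorial : ℂ)⁻¹)).mul (ha.pow n)

/-! ### Linear forms and directional derivatives -/

/-- The linear form `η ↦ (x | η)`. -/
def linForm (x : EuclideanSpace ℝ (Fin d)) : MvPolynomial (Fin d) ℂ := ∑ i, C (x i : ℂ) * X i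

/-- The derivative of a polynomial in the direction `x`. -/
def dirDeriv (x : EuclideanSpace ℝ (Fin d)) :
    MvPolynomial (Fin d) ℂ →ₗ[ℂ] MvPolynomial (Fin d) ℂ :=
  ∑ i, (x i : ℂ) • (pderiv i).toLinearMap

theorem dirDeriv_apply (x : EuclideanSpace ℝ (Fin d)) (P : MvPolynomial (Fin d) ℂ) :
    dirDeriv x P = ∑ i, C (x i : ℂ) * pderiv i P := by
  simp [dirDeriv, LinearMap.sum_apply, smul_eq_C_mul]

theorem evalAt_linForm (x y : EuclideanSpace ℝ (Fin d)) :
    evalAt (linForm x) y = (inner ℝ x y : ℝ) := by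
  simp only [linForm, evalAt_sum, evalAt_mul, evalAt_C, evalAt_X, PiLp.inner_apply]
  push_cast
  exact Finset.sum_congr rfl fun i _ => by simp [mul_comm]

theorem isHomogeneous_linForm (x : EuclideanSpace ℝ (Fin d)) : (linForm x).IsHomogeneous 1 :=
  IsHomogeneous.sum _ _ _ fun i _ => by
    simpa using (isHomogeneous_C (Fin d) (x i : ℂ)).mul (isHomogeneous_X ℂ i)

theorem pderiv_linForm (x : EuclideanSpace ℝ (Fin d)) (i : Fin d) :
    pderiv i (linForm x) = C (x i : ℂ) := by
  rw [linForm, map_sum, Finset.sum_eq_single i]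
  · rw [pderiv_C_mul, pderiv_X_self, mul_one]
  · intro j _ hj
    rw [pderiv_C_mul, pderiv_X_of_ne hj, mul_zero]
  · simp

theorem isHomogeneous_dirDeriv (x : EuclideanSpace ℝ (Fin d)) {P : MvPolynomial (Fin d) ℂ} {l : ℕ}
    (hP : P.IsHomogeneous l) : (dirDeriv x P).IsHomogeneous (l - 1) := by
  rw [dirDeriv_apply]
  exact IsHomogeneous.sum _ _ _ fun i _ => by
    simpa using (isHomogeneous_C (Fin d) (x i : ℂ)).mul hP.pderiv

theorem evalAt_dirDeriv_self (x : EuclideanSpace ℝ (Fin d)) {P : MvPolynomial (Fin d) ℂ} {l : ℕ}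
    (hP : P.IsHomogeneous l) : evalAt (dirDeriv x P) x = l * evalAt P x := by
  have h := congrArg (fun Q => evalAt Q x) hP.sum_X_mul_pderiv
  simp only [evalAt_sum, evalAt_mul, evalAt_X] at h
  rw [dirDeriv_apply, evalAt_sum]
  simp only [evalAt_mul, evalAt_C, h]
  simp [evalAt]

/-- The commutator of two derivations is a derivation, so it suffices that it vanishes on the
variables. -/
theorem pderiv_comm (i j : Fin d) (P : MvPolynomial (Fin d) ℂ) :
    pderiv i (pderiv j P) = pderiv j (pderiv i P) := by
  have h : ⁅pderiv (R := ℂ) i, pderiv (R := ℂ) j⁆ = 0 := by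
    refine derivation_ext fun k => ?_
    simp only [Derivation.commutator_apply, pderiv_X]
    by_cases h1 : k = i <;> by_cases h2 : k = j <;> simp [Pi.single_apply, h1, h2] <;>
      split_ifs <;> simp
  have := congrArg (fun D => D P) h
  simpa [Derivation.commutator_apply, sub_eq_zero] using this

theorem laplacian_dirDeriv (x : EuclideanSpace ℝ (Fin d)) (P : MvPolynomial (Fin d) ℂ) :
    laplacian d (dirDeriv x P) = dirDeriv x (laplacian d P) := by
  simp only [laplacian_apply, dirDeriv_apply, map_sum, pderiv_C_mul]
  rw [Finset.sum_comm]
  refine Finset.sum_congr rfl fun j _ => Finset.sum_congr rfl fun i _ => ?_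
  rw [pderiv_comm i j, pderiv_comm i j P]

theorem laplacian_pow_dirDeriv (x : EuclideanSpace ℝ (Fin d)) (P : MvPolynomial (Fin d) ℂ)
    (k : ℕ) : (laplacian d ^ k) (dirDeriv x P) = dirDeriv x ((laplacian d ^ k) P) := by
  induction k with
  | zero => simp
  | succ k ih => simp only [pow_succ', Module.End.mul_apply, ih, laplacian_dirDeriv]

theorem laplacian_dividedPow_mul (x : EuclideanSpace ℝ (Fin d)) (z : ℤ)
    (P : MvPolynomial (Fin d) ℂ) :
    laplacian d (dividedPow (linForm x) z * P) =
      C ((‖x‖ ^ 2 : ℝ) : ℂ) * (dividedPow (linForm x) (z - 2) * P) +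
        2 * (dividedPow (linForm x) (z - 1) * dirDeriv x P) +
        dividedPow (linForm x) z * laplacian d P := by
  have h1 : laplacian d (dividedPow (linForm x) z) =
      C ((‖x‖ ^ 2 : ℝ) : ℂ) * dividedPow (linForm x) (z - 2) := by
    rw [laplacian_apply, EuclideanSpace.real_norm_sq_eq]
    push_cast
    rw [map_sum, Finset.sum_mul]
    refine Finset.sum_congr rfl fun i _ => ?_
    rw [pderiv_dividedPow, pderiv_linForm, mul_comm, pderiv_C_mul, pderiv_dividedPow,
      pderiv_linForm, show z - 1 - 1 = z - 2 by ring, map_pow]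
    ring
  have h2 : ∑ i, pderiv i (dividedPow (linForm x) z) * pderiv i P =
      dividedPow (linForm x) (z - 1) * dirDeriv x P := by
    rw [dirDeriv_apply, Finset.mul_sum]
    refine Finset.sum_congr rfl fun i _ => ?_
    rw [pderiv_dividedPow, pderiv_linForm]
    ring
  rw [laplacian_mul, h1, h2, mul_assoc]

/-! ### Moments of the sphere -/

theorem integrable_evalAt_sphere (P : MvPolynomial (Fin d) ℂ) (hd : 0 < d) :
    Integrable (fun η : Metric.sphere (0 : EuclideanSpace ℝ (Fin d)) 1 => evalAt P η)
      (sphereMeasure d) :=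
  have := isProbabilityMeasure_sphereMeasure hd
  integrable_sphere_of_continuous ((continuous_evalAt P).comp continuous_subtype_val)

/-- The integral of a polynomial over the sphere. -/
def sphereIntegral (P : MvPolynomial (Fin d) ℂ) : ℂ :=
  ∫ η : Metric.sphere (0 : EuclideanSpace ℝ (Fin d)) 1, evalAt P η ∂sphereMeasure d

theorem sphereIntegral_zero : sphereIntegral (0 : MvPolynomial (Fin d) ℂ) = 0 := by
  simp [sphereIntegral, evalAt_zero]

theorem sphereIntegral_add (hd : 0 < d) (P Q : MvPolynomial (Fin d) ℂ) :
    sphereIntegral (P + Q) = sphereIntegral P + sphereIntegral Q := by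
  simp only [sphereIntegral, evalAt_add]
  exact integral_add (integrable_evalAt_sphere P hd) (integrable_evalAt_sphere Q hd)

theorem sphereIntegral_C_mul (c : ℂ) (P : MvPolynomial (Fin d) ℂ) :
    sphereIntegral (C c * P) = c * sphereIntegral P := by
  simp only [sphereIntegral, evalAt_mul, evalAt_C, integral_const_mul]

theorem sphereIntegral_laplacian (hd : 0 < d) {P : MvPolynomial (Fin d) ℂ} {m : ℕ}
    (hP : P.IsHomogeneous m) :
    sphereIntegral (laplacian d P) = m * (d + m - 2) * sphereIntegral P :=
  integral_laplacian_sphere hd hP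

/-- Repeated Laplacians descend to degree 1, where Δ gives zero; the factors m(d+m-2) met on the way
are nonzero. -/
theorem sphereIntegral_eq_zero_of_odd (hd : 2 ≤ d) (s : ℕ) {P : MvPolynomial (Fin d) ℂ}
    (hP : P.IsHomogeneous (2 * s + 1)) : sphereIntegral P = 0 := by
  have h0 : sphereIntegral (laplacian d P) = 0 := by
    induction s generalizing P with
    | zero => rw [laplacian_eq_zero_of_isHomogeneous hP (by omega), sphereIntegral_zero]
    | succ s ih =>
      have hΔ := isHomogeneous_laplacian hP
      rw [show 2 * (s + 1) + 1 - 2 = 2 * s + 1 by omega] at hΔ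
      have := sphereIntegral_laplacian (by omega) hΔ
      rw [ih hΔ, eq_comm, mul_eq_zero, mul_eq_zero] at this
      refine this.resolve_left (not_or.mpr ⟨by exact_mod_cast (by omega : 2 * s + 1 ≠ 0), ?_⟩)
      rw [show (d : ℂ) + (2 * s + 1 : ℕ) - 2 = ((d - 2 + (2 * s + 1) : ℕ) : ℂ) by
        push_cast [Nat.cast_sub hd]; ring]
      exact Nat.cast_ne_zero.mpr (by omega)
  rw [sphereIntegral_laplacian (by omega) hP, mul_eq_zero, mul_eq_zero] at h0
  refine h0.resolve_left (not_or.mpr ⟨by exact_mod_cast (by omega : 2 * s + 1 ≠ 0), ?_⟩)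
  rw [show (d : ℂ) + (2 * s + 1 : ℕ) - 2 = ((d - 2 + (2 * s + 1) : ℕ) : ℂ) by
    push_cast [Nat.cast_sub hd]; ring]
  exact Nat.cast_ne_zero.mpr (by omega)

/-- The closed form of the moment `∫ (x|η)^z / z! P(η) dσ(η)` for `P` homogeneous of degree
`2 s - z`. -/
def momentFormula (x : EuclideanSpace ℝ (Fin d)) (K s : ℕ) (z : ℤ) (P : MvPolynomial (Fin d) ℂ) :
    ℂ :=
  (Real.Gamma (alpha d + 1) / Real.Gamma (alpha d + 1 + s) : ℝ) / (2 : ℂ) ^ z *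
    ∑ k ∈ Finset.range K, ((4 : ℂ) ^ k * k.factorial)⁻¹ *
      dividedPow ((‖x‖ ^ 2 : ℝ) : ℂ) (k + z - s) * evalAt ((laplacian d ^ k) P) x

theorem momentFormula_zero (x : EuclideanSpace ℝ (Fin d)) (K s : ℕ) (z : ℤ) :
    momentFormula x K s z 0 = 0 := by
  simp [momentFormula, evalAt_zero]

/-- Terms with 2k > l vanish because Δ^k P = 0. Otherwise 2(k+z-s) = 2k-l+z < 0, so the divided
power is zero. -/
theorem momentFormula_of_neg (x : EuclideanSpace ℝ (Fin d)) (K s : ℕ) {z : ℤ} (hz : z < 0)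
    {l : ℕ} {P : MvPolynomial (Fin d) ℂ} (hP : P.IsHomogeneous l) (hl : z + l = 2 * s) :
    momentFormula x K s z P = 0 := by
  rw [momentFormula, Finset.sum_eq_zero, mul_zero]
  intro k _
  by_cases hk : l < 2 * k
  · rw [laplacian_pow_eq_zero_of_isHomogeneous hP hk, evalAt_zero, mul_zero]
  · rw [dividedPow_of_neg _ (by omega), mul_zero, zero_mul]

/-- The right side mirrors the three terms of `laplacian_dividedPow_mul`. A common cut-off `K` for
all of them is harmless, since high powers of Δ annihilate P. -/
theorem momentFormula_recursion (hα : 0 < alpha d) (x : EuclideanSpace ℝ (Fin d)) {K s l : ℕ}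
    (hK : l < 2 * K) {z : ℤ} {P : MvPolynomial (Fin d) ℂ} (hP : P.IsHomogeneous l)
    (hl : z + l = 2 * (s + 1)) :
    4 * (s + 1) * ((alpha d : ℝ) + 1 + s) * momentFormula x K (s + 1) z P =
      ((‖x‖ ^ 2 : ℝ) : ℂ) * momentFormula x K s (z - 2) P +
        2 * momentFormula x K s (z - 1) (dirDeriv x P) + momentFormula x K s z (laplacian d P) := by
  set ρ : ℂ := ((‖x‖ ^ 2 : ℝ) : ℂ)
  set D : ℕ → ℂ := fun k => evalAt ((laplacian d ^ k) P) x with hD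
  set w : ℕ → ℂ := fun k => ((4 : ℂ) ^ k * k.factorial)⁻¹ with hw
  set a : ℕ → ℤ := fun k => k + z - (s + 1) with ha
  have hDz : ∀ k, l < 2 * k → D k = 0 := fun k hk => by
    simp only [hD, laplacian_pow_eq_zero_of_isHomogeneous hP hk, evalAt_zero]
  have h1 : ∀ k : ℕ, evalAt ((laplacian d ^ k) (dirDeriv x P)) x = (l - 2 * k : ℂ) * D k := by
    intro k
    rw [laplacian_pow_dirDeriv, evalAt_dirDeriv_self x (isHomogeneous_laplacian_pow hP k)]
    by_cases hk : l < 2 * k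
    · rw [show evalAt ((laplacian d ^ k) P) x = 0 from hDz k hk, hDz k hk, mul_zero, mul_zero]
    · rw [Nat.cast_sub (by omega)]
      push_cast
      rfl
  have h2 : ∀ k, evalAt ((laplacian d ^ k) (laplacian d P)) x = D (k + 1) := by
    intro k
    simp only [hD, pow_succ, Module.End.mul_apply]
  have hwk : ∀ k : ℕ, w k = 4 * (k + 1) * w (k + 1) := by
    intro k
    have h1 : (k : ℂ) + 1 ≠ 0 := by exact_mod_cast k.succ_ne_zero
    have h2 : (k.factorial : ℂ) ≠ 0 := by exact_mod_cast k.factorial_ne_zero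
    simp only [hw, Nat.factorial_succ, pow_succ]
    push_cast
    field_simp
  have hΓ : ((Real.Gamma (alpha d + 1) / Real.Gamma (alpha d + 1 + s) : ℝ) : ℂ) =
      ((alpha d : ℝ) + 1 + s) *
        (Real.Gamma (alpha d + 1) / Real.Gamma (alpha d + 1 + (s + 1 : ℕ)) : ℝ) := by
    have h3 : alpha d + 1 + s ≠ 0 := by positivity
    have h4 : Real.Gamma (alpha d + 1 + s) ≠ 0 := (Real.Gamma_pos_of_pos (by positivity)).ne'
    push_cast
    rw [← add_assoc, Real.Gamma_add_one h3]
    norm_cast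
    field_simp
  -- What remains of the recursion once the Gamma quotients and powers of 2 are removed.
  have hsum : (s + 1 : ℂ) * ∑ k ∈ Finset.range K, w k * dividedPow ρ (a k) * D k =
      ρ * ∑ k ∈ Finset.range K, w k * dividedPow ρ (a k - 1) * D k +
        ∑ k ∈ Finset.range K, w k * dividedPow ρ (a k) * ((l - 2 * k : ℂ) * D k) +
        (∑ k ∈ Finset.range K, w k * dividedPow ρ (a (k + 1)) * D (k + 1)) / 4 := by
    -- Shift of index: the new term k = 0 carries the factor k, and the top term vanishes because l
    -- < 2K.
    have h3 : (∑ k ∈ Finset.range K, w k * dividedPow ρ (a (k + 1)) * D (k + 1)) / 4 =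
        ∑ k ∈ Finset.range K, (k : ℂ) * (w k * dividedPow ρ (a k) * D k) := by
      have h4 := Finset.sum_range_succ' (fun k : ℕ => (k : ℂ) * (w k * dividedPow ρ (a k) * D k)) K
      rw [Finset.sum_range_succ, hDz K hK, mul_zero, mul_zero, add_zero, Nat.cast_zero, zero_mul,
        add_zero] at h4
      rw [h4, Finset.sum_div]
      refine Finset.sum_congr rfl fun k _ => ?_
      rw [hwk k]
      push_cast
      ring
    rw [h3, Finset.mul_sum, Finset.mul_sum, ← Finset.sum_add_distrib, ← Finset.sum_add_distrib]
    refine Finset.sum_congr rfl fun k _ => ?_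
    have h5 := mul_dividedPow_sub_one ρ (a k)
    rw [smul_eq_mul] at h5
    have h6 : ((a k : ℤ) : ℂ) = s + 1 - l + k := by
      have : a k = s + 1 - l + k := by simp only [ha]; omega
      rw [this]; push_cast; ring
    rw [h6] at h5
    -- Termwise the claim is s+1 = a(k) + (l-2k) + k, the first summand coming from ρ times the
    -- divided power of exponent a(k)-1.
    linear_combination (-(w k * D k)) * h5
  have e1 : ∀ k : ℕ, (k : ℤ) + (z - 2) - s = a k - 1 := fun k => by simp only [ha]; ring
  have e2 : ∀ k : ℕ, (k : ℤ) + (z - 1) - s = a k := fun k => by simp only [ha]; ring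
  have e3 : ∀ k : ℕ, (k : ℤ) + z - s = a (k + 1) := fun k => by simp only [ha]; push_cast; ring
  have e4 : ∀ k : ℕ, (k : ℤ) + z - (s + 1 : ℕ) = a k := fun k => by simp only [ha]; push_cast; ring
  have f0 : momentFormula x K (s + 1) z P =
      (Real.Gamma (alpha d + 1) / Real.Gamma (alpha d + 1 + (s + 1 : ℕ)) : ℝ) / (2 : ℂ) ^ z *
        ∑ k ∈ Finset.range K, w k * dividedPow ρ (a k) * D k := by
    simp only [momentFormula, e4]
    rfl
  have f1 : momentFormula x K s (z - 2) P =
      (Real.Gamma (alpha d + 1) / Real.Gamma (alpha d + 1 + s) : ℝ) / (2 : ℂ) ^ (z - 2) *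
        ∑ k ∈ Finset.range K, w k * dividedPow ρ (a k - 1) * D k := by
    simp only [momentFormula, e1]
    rfl
  have f2 : momentFormula x K s (z - 1) (dirDeriv x P) =
      (Real.Gamma (alpha d + 1) / Real.Gamma (alpha d + 1 + s) : ℝ) / (2 : ℂ) ^ (z - 1) *
        ∑ k ∈ Finset.range K, w k * dividedPow ρ (a k) * ((l - 2 * k : ℂ) * D k) := by
    simp only [momentFormula, e2, h1]
    rfl
  have f3 : momentFormula x K s z (laplacian d P) =
      (Real.Gamma (alpha d + 1) / Real.Gamma (alpha d + 1 + s) : ℝ) / (2 : ℂ) ^ z *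
        ∑ k ∈ Finset.range K, w k * dividedPow ρ (a (k + 1)) * D (k + 1) := by
    simp only [momentFormula, e3, h2]
    rfl
  rw [f0, f1, f2, f3, hΓ, zpow_sub₀ two_ne_zero, zpow_sub₀ two_ne_zero, zpow_one, zpow_ofNat]
  have ht : (2 : ℂ) ^ z ≠ 0 := zpow_ne_zero _ two_ne_zero
  generalize ((Real.Gamma (alpha d + 1) / Real.Gamma (alpha d + 1 + (s + 1 : ℕ)) : ℝ) : ℂ) = G
  generalize (∑ k ∈ Finset.range K, w k * dividedPow ρ (a k) * D k) = S₀ at hsum ⊢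
  generalize (∑ k ∈ Finset.range K, w k * dividedPow ρ (a k - 1) * D k) = S₁ at hsum ⊢
  generalize (∑ k ∈ Finset.range K, w k * dividedPow ρ (a k) * ((l - 2 * k : ℂ) * D k)) = S₂
    at hsum ⊢
  generalize (∑ k ∈ Finset.range K, w k * dividedPow ρ (a (k + 1)) * D (k + 1)) = S₃ at hsum ⊢
  generalize (2 : ℂ) ^ z = t at ht ⊢
  field_simp
  linear_combination 4 * ((alpha d : ℝ) + 1 + s) * G * hsum

/-- Induction on half the total degree s. The sphere identity has factor 2(s+1)(d+2s) =
4(s+1)(α+1+s), matching the recursion for the closed form. -/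
theorem sphereIntegral_dividedPow_mul (hd : 3 ≤ d) (x : EuclideanSpace ℝ (Fin d)) {K s l : ℕ}
    (hK : l < 2 * K) {z : ℤ} {P : MvPolynomial (Fin d) ℂ} (hP : P.IsHomogeneous l)
    (hl : z + l = 2 * s) :
    sphereIntegral (dividedPow (linForm x) z * P) = momentFormula x K s z P := by
  have hα := alpha_pos hd
  induction s generalizing z l P with
  | zero =>
    rcases lt_or_ge z 0 with hz | hz
    · rw [momentFormula_of_neg x K 0 hz hP hl, dividedPow_of_neg _ hz, zero_mul,
        sphereIntegral_zero]
    · obtain rfl : z = 0 := by omega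
      obtain rfl : l = 0 := by omega
      obtain ⟨K, rfl⟩ : ∃ k, K = k + 1 := ⟨K - 1, by omega⟩
      have hΓ : Real.Gamma (alpha d + 1) ≠ 0 := (Real.Gamma_pos_of_pos (by positivity)).ne'
      have := isProbabilityMeasure_sphereMeasure (d := d) (by omega)
      rw [momentFormula, Finset.sum_range_succ', Finset.sum_eq_zero]
      · have hC := totalDegree_eq_zero_iff_eq_C.mp ((totalDegree_zero_iff_isHomogeneous _).mpr hP)
        simp only [dividedPow_zero, one_mul, sphereIntegral, pow_zero, Module.End.one_apply]
        rw [hC]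
        simp [evalAt_C, hΓ, dividedPow_zero]
      · intro k _
        rw [laplacian_pow_eq_zero_of_isHomogeneous hP (by omega), evalAt_zero, mul_zero]
  | succ s ih =>
    rcases lt_or_ge z 0 with hz | hz
    · rw [momentFormula_of_neg x K _ hz hP hl, dividedPow_of_neg _ hz, zero_mul,
        sphereIntegral_zero]
    · push_cast at hl
      obtain ⟨n, rfl⟩ := Int.eq_ofNat_of_zero_le hz
      have hhom : (dividedPow (linForm x) (n : ℤ) * P).IsHomogeneous (2 * (s + 1)) := by
        have := (isHomogeneous_dividedPow (isHomogeneous_linForm x) n).mul hP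
        rwa [show n + l = 2 * (s + 1) by omega] at this
      have hrec := sphereIntegral_laplacian (by omega) hhom
      have e1 := ih hK hP (z := n - 2) (by omega)
      have e2 : sphereIntegral (dividedPow (linForm x) ((n : ℤ) - 1) * dirDeriv x P) =
          momentFormula x K s (n - 1) (dirDeriv x P) := by
        -- For l = 0 the degree l-1 is truncated and the induction hypothesis does not apply, but
        -- then P is constant and its derivative is zero.
        rcases Nat.eq_zero_or_pos l with rfl | hl0
        · have : dirDeriv x P = 0 := by
            rw [dirDeriv_apply]
            exact Finset.sum_eq_zero fun i _ => by
              rw [pderiv_eq_zero_of_isHomogeneous_zero hP, mul_zero]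
          rw [this, mul_zero, sphereIntegral_zero, momentFormula_zero]
        · exact ih (by omega) (isHomogeneous_dirDeriv x hP) (by omega)
      have e3 : sphereIntegral (dividedPow (linForm x) (n : ℤ) * laplacian d P) =
          momentFormula x K s n (laplacian d P) := by
        rcases lt_or_ge l 2 with hl0 | hl0
        · rw [laplacian_eq_zero_of_isHomogeneous hP hl0, mul_zero, sphereIntegral_zero,
            momentFormula_zero]
        · exact ih (by omega) (isHomogeneous_laplacian hP) (by omega)
      rw [laplacian_dividedPow_mul, sphereIntegral_add (by omega), sphereIntegral_add (by omega),
        sphereIntegral_C_mul, ← map_ofNat C 2, sphereIntegral_C_mul, e1, e2, e3,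
        ← momentFormula_recursion hα x hK hP hl] at hrec
      have hc : (4 * (s + 1) * ((alpha d : ℝ) + 1 + s) : ℂ) ≠ 0 := by
        have : (4 * (s + 1) * (alpha d + 1 + s) : ℝ) ≠ 0 := by positivity
        exact_mod_cast this
      refine mul_left_cancel₀ hc (Eq.trans ?_ hrec.symm)
      simp only [alpha]
      push_cast
      ring

/-! ### The Fourier transform as a power series -/

/-- Since |(x|η)| ≤ |x| on the sphere, the Taylor terms are dominated by an exponential series, so
sum and integral may be exchanged. -/
theorem hasSum_sphereFourier (hd : 0 < d) (P : MvPolynomial (Fin d) ℂ)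
    (x : EuclideanSpace ℝ (Fin d)) :
    HasSum (fun n : ℕ => Complex.I ^ n * sphereIntegral (dividedPow (linForm x) (n : ℤ) * P))
      (sphereFourier P x) := by
  have := isProbabilityMeasure_sphereMeasure hd
  obtain ⟨M, hM⟩ : ∃ M, ∀ η : Metric.sphere (0 : EuclideanSpace ℝ (Fin d)) 1,
      ‖evalAt P (η : EuclideanSpace ℝ (Fin d))‖ ≤ M := by
    obtain ⟨M, hM⟩ := (isCompact_sphere (0 : EuclideanSpace ℝ (Fin d)) 1).exists_bound_of_continuousOn
      (continuous_evalAt P).continuousOn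
    exact ⟨M, fun η => hM η η.2⟩
  set F : ℕ → Metric.sphere (0 : EuclideanSpace ℝ (Fin d)) 1 → ℂ := fun n η =>
    Complex.I ^ n * evalAt (dividedPow (linForm x) (n : ℤ) * P) η with hF
  have hFeq : ∀ n η, F n η = (Complex.I * (inner ℝ x (η : EuclideanSpace ℝ (Fin d)) : ℝ)) ^ n /
      n.factorial * evalAt P (η : EuclideanSpace ℝ (Fin d)) := by
    intro n η
    simp only [hF]
    rw [dividedPow_natCast, smul_eq_C_mul, evalAt_mul, evalAt_mul, evalAt_C, evalAt_pow,
      evalAt_linForm]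
    ring
  have hFint : ∀ n, Integrable (F n) (sphereMeasure d) := fun n =>
    (integrable_evalAt_sphere _ hd).const_mul _
  have hFle : ∀ n η, ‖F n η‖ ≤ ‖x‖ ^ n / n.factorial * M := by
    intro n η
    rw [hFeq, norm_mul, norm_div, norm_pow, norm_mul, Complex.norm_I, one_mul, Complex.norm_real,
      Complex.norm_natCast]
    have h1 : ‖(inner ℝ x (η : EuclideanSpace ℝ (Fin d)) : ℝ)‖ ≤ ‖x‖ := by
      have h2 := norm_inner_le_norm (𝕜 := ℝ) x (η : EuclideanSpace ℝ (Fin d))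
      rwa [norm_eq_of_mem_sphere η, mul_one] at h2
    gcongr
    exact hM η
  have hsum : Summable fun n => ∫ η, ‖F n η‖ ∂sphereMeasure d := by
    refine Summable.of_nonneg_of_le (fun n => integral_nonneg fun η => norm_nonneg _) (fun n => ?_)
      ((Real.summable_pow_div_factorial ‖x‖).mul_right M)
    calc ∫ η, ‖F n η‖ ∂sphereMeasure d
        ≤ ∫ _, ‖x‖ ^ n / n.factorial * M ∂sphereMeasure d :=
          integral_mono (hFint n).norm (integrable_const _) (hFle n)
      _ = ‖x‖ ^ n / n.factorial * M := by simp
  have h := hasSum_integral_of_summable_integral_norm hFint hsum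
  convert! h using 1
  · funext n
    simp only [hF, sphereIntegral, integral_const_mul]
  · refine integral_congr_ae (Filter.Eventually.of_forall fun η => ?_)
    simp only [hFeq, tsum_mul_right]
    rw [Complex.exp_eq_exp_ℂ, NormedSpace.exp_eq_tsum_div]

theorem Gamma_le_Gamma_add_natCast {ν : ℝ} (hν : 0 ≤ ν) (m : ℕ) :
    Real.Gamma (ν + 1) ≤ Real.Gamma (m + ν + 1) := by
  induction m with
  | zero => simp
  | succ m ih =>
    have hpos : 0 < (m : ℝ) + ν + 1 := by positivity
    have h := Real.Gamma_add_one hpos.ne'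
    push_cast
    rw [show (m : ℝ) + 1 + ν + 1 = m + ν + 1 + 1 by ring, h]
    have h1 : (1 : ℝ) ≤ m + ν + 1 := by linarith [(Nat.cast_nonneg m : (0 : ℝ) ≤ m)]
    exact ih.trans (le_mul_of_one_le_left (Real.Gamma_pos_of_pos hpos).le h1)

theorem hasSum_sphBessel {ν : ℝ} (hν : 0 ≤ ν) (t : ℝ) :
    HasSum (fun m : ℕ => Real.Gamma (ν + 1) * ((-1) ^ m / (m.factorial * Real.Gamma (m + ν + 1)) *
      (t / 2) ^ (2 * m))) (sphBessel ν t) := by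
  have hΓ : 0 < Real.Gamma (ν + 1) := Real.Gamma_pos_of_pos (by linarith)
  have hs : Summable fun m : ℕ => (-1 : ℝ) ^ m / (m.factorial * Real.Gamma (m + ν + 1)) *
      (t / 2) ^ (2 * m) := by
    refine Summable.of_norm_bounded
      ((Real.summable_pow_div_factorial ((t / 2) ^ 2)).mul_right (Real.Gamma (ν + 1))⁻¹)
      fun m => ?_
    have hΓm := Gamma_le_Gamma_add_natCast hν m
    have hΓm0 : 0 < Real.Gamma (m + ν + 1) := hΓ.trans_le hΓm
    rw [norm_mul, norm_div, norm_pow, norm_neg, norm_one, one_pow, norm_mul, Real.norm_natCast,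
      Real.norm_of_nonneg hΓm0.le, Real.norm_of_nonneg (by rw [pow_mul]; positivity), pow_mul,
      div_mul_eq_mul_div, one_mul, div_mul_eq_div_div, div_eq_mul_inv _ (Real.Gamma _)]
    gcongr
  have h := hs.hasSum.mul_left (Real.Gamma (ν + 1))
  simpa only [sphBessel, Real.Gamma_nat_eq_factorial] using h

/-- The `n`-th Taylor term of the contribution of `Δ^k P` to the Fourier transform of `P dσ`. -/
def fourierTerm (d l : ℕ) (x : EuclideanSpace ℝ (Fin d)) (k n : ℕ) : ℂ :=
  if Even (n + l) then
    Complex.I ^ n * ((Real.Gamma (alpha d + 1) /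
      Real.Gamma (alpha d + 1 + ((n + l) / 2 : ℕ)) : ℝ) / (2 : ℂ) ^ n) *
      (((4 : ℂ) ^ k * k.factorial)⁻¹ *
        dividedPow ((‖x‖ ^ 2 : ℝ) : ℂ) (k + n - ((n + l) / 2 : ℕ)))
  else 0

theorem moment_eq_sum_fourierTerm (hd : 3 ≤ d) {l : ℕ} {P : MvPolynomial (Fin d) ℂ}
    (hP : P.IsHomogeneous l) (x : EuclideanSpace ℝ (Fin d)) (n : ℕ) :
    Complex.I ^ n * sphereIntegral (dividedPow (linForm x) (n : ℤ) * P) =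
      ∑ k ∈ Finset.range (l / 2 + 1),
        fourierTerm d l x k n * evalAt ((laplacian d ^ k) P) x := by
  rcases Nat.even_or_odd (n + l) with h | h
  · obtain ⟨s, hs⟩ := h
    have hs2 : (n + l) / 2 = s := by omega
    have he : Even (n + l) := ⟨s, hs⟩
    rw [sphereIntegral_dividedPow_mul hd x (K := l / 2 + 1) (s := s) (by omega) hP (by omega),
      momentFormula, Finset.mul_sum, Finset.mul_sum]
    refine Finset.sum_congr rfl fun k _ => ?_
    rw [fourierTerm, if_pos he, hs2, zpow_natCast]
    ring
  · obtain ⟨s, hs⟩ := h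
    have hhom := (isHomogeneous_dividedPow (isHomogeneous_linForm x) n).mul hP
    rw [hs] at hhom
    have hne : ¬ Even (n + l) := by rw [hs]; simp [parity_simps]
    rw [sphereIntegral_eq_zero_of_odd (by omega) s hhom, mul_zero, Finset.sum_eq_zero]
    intro k _
    rw [fourierTerm, if_neg hne, zero_mul]

/-- Only n = 2m + (l-2k) contributes. For these n the divided power has exponent m, and the series
in m is that of the Bessel function of order α+l-k. -/
theorem hasSum_fourierTerm (hd : 3 ≤ d) {l k : ℕ} (hk : k ≤ l / 2)
    (x : EuclideanSpace ℝ (Fin d)) :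
    HasSum (fourierTerm d l x k)
      ((Complex.I / 2) ^ l * (((-1) ^ k * Real.Gamma (alpha d + 1) /
        (k.factorial * Real.Gamma (alpha d + l + 1 - k)) *
        sphBessel (alpha d + l - k) ‖x‖ : ℝ) : ℂ)) := by
  have hα := alpha_pos hd
  have hkl : (2 * k : ℝ) ≤ l := by exact_mod_cast (by omega : 2 * k ≤ l)
  have hk0 : (0 : ℝ) ≤ k := Nat.cast_nonneg k
  have hν : 0 ≤ alpha d + l - k := by linarith
  have hinj : Function.Injective fun m : ℕ => 2 * m + (l - 2 * k) := fun a b h => by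
    simp only at h
    omega
  refine (hinj.hasSum_iff ?_).mp ?_
  · intro n hn
    rw [fourierTerm]
    split_ifs with he
    · obtain ⟨s, hs⟩ := he
      rw [dividedPow_of_neg, mul_zero, mul_zero]
      by_contra hneg
      -- The exponent of the divided power is itself the index m: if it is nonnegative, n lies in
      -- the range of the reindexing.
      refine hn ⟨k + n - (n + l) / 2, ?_⟩
      simp only
      omega
    · rfl
  · have hB := ((Complex.hasSum_ofReal.mpr (hasSum_sphBessel hν ‖x‖)).mul_left
      ((Complex.I / 2) ^ l * (((-1) ^ k * Real.Gamma (alpha d + 1) /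
        (k.factorial * Real.Gamma (alpha d + l + 1 - k)) : ℝ) : ℂ)))
    convert! hB using 1
    · funext m
      have he : Even (2 * m + (l - 2 * k) + l) := ⟨m + l - k, by omega⟩
      have hs : (2 * m + (l - 2 * k) + l) / 2 = m + l - k := by omega
      have hdp : (k : ℤ) + (2 * m + (l - 2 * k) : ℕ) - (m + l - k : ℕ) = (m : ℕ) := by omega
      have hΓ : Real.Gamma (alpha d + l + 1 - k) ≠ 0 :=
        (Real.Gamma_pos_of_pos (by linarith)).ne'
      have hΓ' : Real.Gamma (m + (alpha d + l - k) + 1) ≠ 0 :=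
        (Real.Gamma_pos_of_pos (by positivity)).ne'
      have hc : alpha d + 1 + (m + l - k : ℕ) = m + (alpha d + l - k) + 1 := by
        rw [Nat.cast_sub (by omega)]; push_cast; ring
      simp only [Function.comp_apply, fourierTerm]
      rw [if_pos he, hs, hdp, dividedPow_natCast, hc,
        show alpha d + l - k + 1 = alpha d + l + 1 - k by ring]
      have hI : (Complex.I / 2) ^ l = (Complex.I / 2) ^ (l - 2 * k) * ((-1) ^ k / 4 ^ k) := by
        conv_lhs => rw [show l = (l - 2 * k) + 2 * k by omega]
        rw [pow_add, pow_mul (Complex.I / 2) 2 k, div_pow Complex.I 2 2, Complex.I_sq, div_pow (-1 : ℂ)]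
        norm_num
      have hI2 : Complex.I ^ (2 * m + (l - 2 * k)) / 2 ^ (2 * m + (l - 2 * k)) =
          (Complex.I / 2) ^ (l - 2 * k) * ((-1) ^ m / 4 ^ m) := by
        rw [← div_pow, pow_add, pow_mul, div_pow Complex.I 2 2, Complex.I_sq, div_pow]
        norm_num
        ring
      have h1 : ((-1 : ℂ) ^ k) * (-1) ^ k = 1 := by rw [← mul_pow]; norm_num
      have hfk : (k.factorial : ℂ) ≠ 0 := by exact_mod_cast k.factorial_ne_zero
      have hfm : (m.factorial : ℂ) ≠ 0 := by exact_mod_cast m.factorial_ne_zero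
      have hΓc : ((Real.Gamma (alpha d + l + 1 - k) : ℝ) : ℂ) ≠ 0 := by exact_mod_cast hΓ
      have hΓc' : ((Real.Gamma (m + (alpha d + l - k) + 1) : ℝ) : ℂ) ≠ 0 := by exact_mod_cast hΓ'
      rw [hI, mul_div_assoc', mul_div_right_comm, hI2, pow_mul (‖x‖ / 2), div_pow ‖x‖ 2 2,
        div_pow (‖x‖ ^ 2)]
      push_cast
      rw [smul_eq_mul, show ((2 : ℂ) ^ 2) = 4 by norm_num]
      field_simp
      linear_combination (-(Real.Gamma (alpha d + 1) : ℂ) * (‖x‖ : ℂ) ^ (2 * m)) * h1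
    · push_cast
      ring

theorem sphereFourier_eq_sum_laplacian (hd : 3 ≤ d) {l : ℕ} {P : MvPolynomial (Fin d) ℂ}
    (hP : P.IsHomogeneous l) (x : EuclideanSpace ℝ (Fin d)) :
    sphereFourier P x =
      (Complex.I / 2) ^ l * ∑ k ∈ Finset.range (l / 2 + 1),
        (((-1) ^ k * Real.Gamma (alpha d + 1) /
            (k.factorial * Real.Gamma (alpha d + l + 1 - k)) *
            sphBessel (alpha d + l - k) ‖x‖ : ℝ) : ℂ) *
          evalAt ((laplacian d ^ k) P) x := by
  have h1 := hasSum_sphereFourier (by omega) P x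
  simp only [moment_eq_sum_fourierTerm hd hP] at h1
  have h2 := hasSum_sum fun k (hk : k ∈ Finset.range (l / 2 + 1)) =>
    (hasSum_fourierTerm hd (l := l) (by simpa [Nat.lt_succ_iff] using hk) x).mul_right
      (evalAt ((laplacian d ^ k) P) x)
  rw [h1.unique h2, Finset.mul_sum]
  exact Finset.sum_congr rfl fun k _ => mul_assoc _ _ _

theorem sphereFourier_of_harmonic (hd : 3 ≤ d) {l : ℕ} {P : MvPolynomial (Fin d) ℂ}
    (hP : P ∈ harmonicSubmodule d l) (x : EuclideanSpace ℝ (Fin d)) :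
    sphereFourier P x = (Complex.I / 2) ^ l *
      ((Real.Gamma (alpha d + 1) / Real.Gamma (alpha d + l + 1) *
        sphBessel (alpha d + l) ‖x‖ : ℝ) : ℂ) * evalAt P x := by
  obtain ⟨hhom, h0⟩ := mem_harmonicSubmodule.mp hP
  rw [sphereFourier_eq_sum_laplacian hd hhom, Finset.sum_range_succ', Finset.sum_eq_zero]
  · simp [mul_assoc]
  · intro k _
    rw [pow_succ (laplacian d), Module.End.mul_apply, h0, map_zero, evalAt_zero, mul_zero]

theorem sphereFourier_eq_sum_of_isHarmonicDecomposition (hd : 0 < d) {l : ℕ}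
    {P : MvPolynomial (Fin d) ℂ} {h : ℕ → MvPolynomial (Fin d) ℂ}
    (H : IsHarmonicDecomposition l P h) (x : EuclideanSpace ℝ (Fin d)) :
    sphereFourier P x = ∑ k ∈ Finset.range (l / 2 + 1), sphereFourier (h k) x := by
  have := isProbabilityMeasure_sphereMeasure hd
  simp only [sphereFourier]
  rw [← integral_finsetSum]
  · refine integral_congr_ae (Filter.Eventually.of_forall fun η => ?_)
    simp only
    rw [← Finset.mul_sum]
    conv_lhs => rw [H.2]
    simp [evalAt_sum, evalAt_mul, evalAt_pow, evalAt_rSq]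
  · intro k _
    refine integrable_sphere_of_continuous (Continuous.mul ?_
      ((continuous_evalAt _).comp continuous_subtype_val))
    fun_prop

end SphereFourier

end

open SphereFourier in
theorem theorem3 (d : ℕ) (hd : 3 ≤ d) (l : ℕ) (P : MvPolynomial (Fin d) ℂ)
    (hP : P ∈ MvPolynomial.homogeneousSubmodule (Fin d) ℂ l) :
    -- the `h_{l-2k}(P)` are the harmonic components of `P`
    (SphereFourier.IsHarmonicDecomposition l P
        (fun k => SphereFourier.harmonicComponent l k P) ∧
      ∀ h : ℕ → MvPolynomial (Fin d) ℂ, SphereFourier.IsHarmonicDecomposition l P h →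
        ∀ k ≤ l / 2, h k = SphereFourier.harmonicComponent l k P) ∧
    -- the two forms of the Fourier transform
    ∀ x : EuclideanSpace ℝ (Fin d),
      SphereFourier.sphereFourier P x =
        (Complex.I / 2) ^ l * ∑ k ∈ Finset.range (l / 2 + 1),
          (((-1) ^ k * 2 ^ (2 * k) * Real.Gamma (SphereFourier.alpha d + 1) /
              Real.Gamma (SphereFourier.alpha d + l + 1 - 2 * k) *
              SphereFourier.sphBessel (SphereFourier.alpha d + l - 2 * k) ‖x‖ : ℝ) : ℂ) *
            SphereFourier.evalAt (SphereFourier.harmonicComponent l k P) x ∧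
      SphereFourier.sphereFourier P x =
        (Complex.I / 2) ^ l * ∑ k ∈ Finset.range (l / 2 + 1),
          (((-1) ^ k * Real.Gamma (SphereFourier.alpha d + 1) /
              (k.factorial * Real.Gamma (SphereFourier.alpha d + l + 1 - k)) *
              SphereFourier.sphBessel (SphereFourier.alpha d + l - k) ‖x‖ : ℝ) : ℂ) *
            SphereFourier.evalAt ((SphereFourier.laplacian d ^ k) P) x := by
  have hα := alpha_pos hd
  rw [MvPolynomial.mem_homogeneousSubmodule] at hP
  have H := isHarmonicDecomposition_harmonicComponent hα hP
  refine ⟨⟨H, fun h H' k hk => H'.eq_harmonicComponent hα hP hk⟩,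
    fun x => ⟨?_, sphereFourier_eq_sum_laplacian hd hP x⟩⟩
  rw [sphereFourier_eq_sum_of_isHarmonicDecomposition (by omega) H, Finset.mul_sum]
  refine Finset.sum_congr rfl fun k hk => ?_
  have hk : k ≤ l / 2 := by simpa [Nat.lt_succ_iff] using hk
  -- As (i/2)² = -1/4, the factor (-1)^k 4^k trades the prefactor for degree l for the one for
  -- degree l-2k.
  have hI : (Complex.I / 2) ^ l * ((-1) ^ k * 2 ^ (2 * k)) = (Complex.I / 2) ^ (l - 2 * k) := by
    conv_lhs => rw [show l = (l - 2 * k) + 2 * k by omega]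
    rw [pow_add, pow_mul (Complex.I / 2) 2 k, pow_mul 2 2 k, mul_assoc, ← mul_pow, ← mul_pow,
      div_pow Complex.I 2 2, Complex.I_sq]
    norm_num
  rw [sphereFourier_of_harmonic hd (H.1 k hk), ← hI, Nat.cast_sub (by omega)]
  push_cast
  rw [← add_sub_assoc, show alpha d + l - 2 * k + 1 = alpha d + l + 1 - 2 * k by ring]
  ring
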